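/- Let $d\ge 1$ and write points of $\mathbb R^{d+1}$ as $z=(t,x)$ with $t\in\mathbb R$, $x\in\mathbb R^d$. For $\rho\in(0,\infty]$ set $$C_\rho(t,x)=\{(s,y)\in\mathbb R^{d+1}: |x-y|<\rho,\ t\le s<t+\rho^2\},\qquad C_\rho=C_\rho(0,0),$$ so that $C_\infty=[0,\infty)\times\mathbb R^d$. For $Q\subset\mathbb R^{d+1}$ measurable, $p\in[1,\infty)$ and $\beta\in(0,(d+2)/p]$ let $$\|g\|_{E_{p,\beta}(Q)}=\sup_{0<\rho<\infty,\ z\in Q}\rho^\beta\Big(\frac1{|C_\rho(z)|}\int_{C_\rho(z)}|g I_Q|^p\,dz'\Big)^{1/p}.$$ Let $Du=(D_iu)_{i}$ and $D^2u=(D_iD_ju)_{i,j}$ denote the first and second derivatives in $x$ only, with Euclidean norms $|Du|$ and $|D^2u|=(\sum_{i,j}|D_iD_ju|^2)^{1/2}$. Theorem 3.10. Let $1<q<d+2$, $\beta\in(1,(d+2)/q]$ and let $r$ be defined by $r(\beta-1)=q\beta$. Then there is a constant $N<\infty$, depending only on $d,q,\beta$, such that for every $R\in(0,\infty]$ and every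 real-valued $u\in C_0^\infty(\mathbb R^{d+1})$ (smooth with compact support) $$\|Du\|_{E_{r,\beta-1}(C_R)}\le N\,\big\|\,|\partial_tu|+|D^2u|\,\big\|_{E_{q,\beta}(C_R)}+N R^{-2}\|u\|_{E_{q,\beta}(C_R)},$$ where $R^{-2}=0$ if $R=\infty$. -/

import Mathlib

open MeasureTheory Set
open scoped ENNReal NNReal ContDiff

noncomputable section

namespace ParabolicMorrey

/-- Space-time `ℝ^{d+1}`, with points `z = (t, x)`, `t ∈ ℝ`, `x ∈ ℝ^d` (Euclidean norm on `ℝ^d`);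
`volume` on it is the `(d+1)`-dimensional Lebesgue measure. -/
abbrev SpaceTime (d : ℕ) : Type := ℝ × EuclideanSpace ℝ (Fin d)

/-- The parabolic cylinder `C_ρ(t, x) = {(s, y) : |x - y| < ρ, t ≤ s < t + ρ²}` for `ρ ∈ [0, ∞]`.
The radius `ρ = ∞` gives the half-space `[t, ∞) × ℝ^d`. -/
def cylinder {d : ℕ} (ρ : ℝ≥0∞) (z : SpaceTime d) : Set (SpaceTime d) :=
  {w | edist z.2 w.2 < ρ ∧ z.1 ≤ w.1 ∧ ENNReal.ofReal (w.1 - z.1) < ρ ^ 2}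

/-- For a finite radius, `cylinder` is given by the usual real inequalities. -/
theorem mem_cylinder_ofReal {d : ℕ} {ρ : ℝ} (hρ : 0 < ρ) (z w : SpaceTime d) :
    w ∈ cylinder (ENNReal.ofReal ρ) z ↔
      ‖z.2 - w.2‖ < ρ ∧ z.1 ≤ w.1 ∧ w.1 < z.1 + ρ ^ 2 := by
  have h2 : (0 : ℝ) < ρ ^ 2 := by positivity
  simp only [cylinder, mem_ofPred_eq, edist_dist, dist_eq_norm,
    ← ENNReal.ofReal_pow hρ.le, ENNReal.ofReal_lt_ofReal_iff hρ, ENNReal.ofReal_lt_ofReal_iff h2,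
    sub_lt_iff_lt_add']

theorem mem_cylinder_top {d : ℕ} (z w : SpaceTime d) :
    w ∈ cylinder ∞ z ↔ z.1 ≤ w.1 := by
  simp [cylinder, edist_lt_top]

/-- The Morrey norm
`‖g‖_{E_{p,β}(Q)} = sup_{0 < ρ < ∞, z ∈ Q} ρ^β (⨍_{C_ρ(z)} |g I_Q|^p)^{1/p}`,
with values in `[0, ∞]`; the inner integral is the average over `C_ρ(z)`. -/
def morreyNorm {d : ℕ} {F : Type*} [NormedAddCommGroup F] (p β : ℝ) (Q : Set (SpaceTime d))
    (g : SpaceTime d → F) : ℝ≥0∞ :=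
  ⨆ (ρ : ℝ) (_ : 0 < ρ) (z : SpaceTime d) (_ : z ∈ Q),
    ENNReal.ofReal ρ ^ β *
      (⨍⁻ w in cylinder (ENNReal.ofReal ρ) z, ‖Q.indicator g w‖ₑ ^ p ∂volume) ^ (1 / p)

/-- The time derivative `∂_t u`. -/
def timeDeriv {d : ℕ} (u : SpaceTime d → ℝ) (z : SpaceTime d) : ℝ :=
  deriv (fun s : ℝ => u (s, z.2)) z.1

/-- The spatial partial derivative `D_i u = ∂u/∂x^i`. -/
def spaceDeriv {d : ℕ} (i : Fin d) (u : SpaceTime d → ℝ) (z : SpaceTime d) : ℝ :=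
  lineDeriv ℝ (fun x : EuclideanSpace ℝ (Fin d) => u (z.1, x)) z.2 (EuclideanSpace.single i 1)

/-- The spatial gradient `Du = (D_1 u, …, D_d u)`; `‖Du‖` is its Euclidean length. -/
def spaceGrad {d : ℕ} (u : SpaceTime d → ℝ) (z : SpaceTime d) : EuclideanSpace ℝ (Fin d) :=
  WithLp.toLp 2 fun i => spaceDeriv i u z

/-- The matrix `D²u = (D_i D_j u)` of second spatial derivatives;
`‖D²u‖ = (∑_{i,j} |D_i D_j u|²)^{1/2}`. -/
def spaceHess {d : ℕ} (u : SpaceTime d → ℝ) (z : SpaceTime d) :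
    EuclideanSpace ℝ (Fin d × Fin d) :=
  WithLp.toLp 2 fun ij => spaceDeriv ij.1 (spaceDeriv ij.2 u) z

end ParabolicMorrey

end

namespace ParabolicMorrey

variable {d : ℕ}

/-! This is an Adams-type embedding, proved by a potential representation and Hedberg's splitting.
Write `f` for `|∂_t u| + |D²u|` and `E` for its Morrey norm.

For `z` in `C_R`, contract `C_R` parabolically towards `z` with ratio `l ∈ (0, 1]`; the image is a
cylinder of radius `lR` that contains `z` and stays in `C_R`. Differentiating `D_i u` along the
contraction and averaging against a bump function expresses `D_i u(z)` through its average over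
`C_R` and the derivatives of `D_i u` over the contracted cylinders. Spatial integration by parts
turns the first into an average of `u` and removes the mixed derivative `∂_t D_i u`. Hence `|Du(z)|`
is bounded by `R⁻¹` times the mean of `|u|` on `C_R`, plus `R` times the integral over `l` of the
means of `f` (`exists_enorm_spaceGrad_le`).

These means are at most `(lR)^(-β) E`, and also at most a local maximal function plus a constant
(`laverage_le_majorant`). Using the better bound at each radius gives `M^(1 - 1/β) E^(1/β)`, up to a
constant, with `M` this majorant (`ofReal_mul_lintegral_le`). Since `r (1 - 1/β) = q`, the `L^r`
mean of the result is controlled by the `L^q` mean of `M`, which the strong type maximal inequality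
bounds by `ρ^(-β) E` (`laverage_majorant_rpow_le`). The case `R = ∞` follows by letting `R → ∞`,
because the Morrey norm of a test function is finite. -/

theorem cylinder_ofReal_eq {ρ : ℝ} (hρ : 0 < ρ) (z : SpaceTime d) :
    cylinder (ENNReal.ofReal ρ) z = Ico z.1 (z.1 + ρ ^ 2) ×ˢ Metric.ball z.2 ρ := by
  ext w
  rw [mem_cylinder_ofReal hρ, mem_prod, mem_Ico, Metric.mem_ball, dist_comm, dist_eq_norm]
  tauto

theorem measurableSet_cylinder_ofReal {ρ : ℝ} (hρ : 0 < ρ) (z : SpaceTime d) :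
    MeasurableSet (cylinder (ENNReal.ofReal ρ) z) := by
  rw [cylinder_ofReal_eq hρ]
  exact measurableSet_Ico.prod measurableSet_ball

/-! ### Volumes of cylinders -/

/-- The volume of the unit ball of `ℝ^d`, which is also the volume of the unit cylinder. -/
noncomputable def unitVol (d : ℕ) : ℝ≥0∞ := volume (Metric.ball (0 : EuclideanSpace ℝ (Fin d)) 1)

theorem unitVol_pos : 0 < unitVol d := Metric.measure_ball_pos _ _ one_pos

theorem unitVol_ne_zero : unitVol d ≠ 0 := unitVol_pos.ne'

theorem unitVol_ne_top : unitVol d ≠ ⊤ := measure_ball_lt_top.ne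

theorem volume_prod_ball {b ρ : ℝ} (hρ : 0 < ρ) (x : EuclideanSpace ℝ (Fin d)) {I : Set ℝ}
    (hI : volume I = ENNReal.ofReal (b * ρ ^ 2)) (hb : 0 ≤ b) :
    volume (I ×ˢ Metric.ball x ρ) = ENNReal.ofReal b * ENNReal.ofReal (ρ ^ (d + 2)) * unitVol d := by
  rw [Measure.volume_eq_prod, Measure.prod_prod, hI, Measure.addHaar_ball_of_pos _ _ hρ, unitVol,
    finrank_euclideanSpace_fin, ← mul_assoc, ← ENNReal.ofReal_mul (by positivity),
    ← ENNReal.ofReal_mul hb]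
  ring_nf

theorem volume_cylinder {ρ : ℝ} (hρ : 0 < ρ) (z : SpaceTime d) :
    volume (cylinder (ENNReal.ofReal ρ) z) = ENNReal.ofReal (ρ ^ (d + 2)) * unitVol d := by
  rw [cylinder_ofReal_eq hρ, volume_prod_ball (b := 1) hρ _ (by simp) zero_le_one]
  simp

theorem volume_cylinder_ne_zero {ρ : ℝ} (hρ : 0 < ρ) (z : SpaceTime d) :
    volume (cylinder (ENNReal.ofReal ρ) z) ≠ 0 := by
  rw [volume_cylinder hρ]
  exact mul_ne_zero (by simpa using pow_pos hρ _) unitVol_ne_zero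

theorem volume_cylinder_ne_top {ρ : ℝ} (hρ : 0 < ρ) (z : SpaceTime d) :
    volume (cylinder (ENNReal.ofReal ρ) z) ≠ ⊤ := by
  rw [volume_cylinder hρ]
  exact ENNReal.mul_ne_top ENNReal.ofReal_ne_top unitVol_ne_top

/-! ### Parabolic boxes and the maximal function -/

/-- The open two-sided parabolic box of radius `ρ` centred at `z`. -/
def box (ρ : ℝ) (z : SpaceTime d) : Set (SpaceTime d) :=
  Ioo (z.1 - ρ ^ 2) (z.1 + ρ ^ 2) ×ˢ Metric.ball z.2 ρ

theorem isOpen_box (ρ : ℝ) (z : SpaceTime d) : IsOpen (box ρ z) := isOpen_Ioo.prod Metric.isOpen_ball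

theorem volume_box {ρ : ℝ} (hρ : 0 < ρ) (z : SpaceTime d) :
    volume (box ρ z) = 2 * ENNReal.ofReal (ρ ^ (d + 2)) * unitVol d := by
  rw [box, volume_prod_ball (b := 2) hρ _ (by rw [Real.volume_Ioo]; ring_nf) zero_le_two]
  simp

theorem volume_box_ne_zero {ρ : ℝ} (hρ : 0 < ρ) (z : SpaceTime d) : volume (box ρ z) ≠ 0 := by
  rw [volume_box hρ]
  exact mul_ne_zero (mul_ne_zero two_ne_zero (by simpa using pow_pos hρ _)) unitVol_ne_zero

theorem volume_box_ne_top {ρ : ℝ} (hρ : 0 < ρ) (z : SpaceTime d) : volume (box ρ z) ≠ ⊤ := by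
  rw [volume_box hρ]
  exact ENNReal.mul_ne_top (ENNReal.mul_ne_top (by simp) ENNReal.ofReal_ne_top) unitVol_ne_top

theorem cylinder_subset_box {ρ : ℝ} (hρ : 0 < ρ) (z : SpaceTime d) :
    cylinder (ENNReal.ofReal ρ) z ⊆ box ρ z := by
  rw [cylinder_ofReal_eq hρ]
  refine prod_mono (fun s hs => ⟨?_, hs.2⟩) subset_rfl
  have : 0 < ρ ^ 2 := by positivity
  linarith [hs.1]

/-- The triangle inequality gives spatial distance below `2ρ + σ ≤ 5σ` and time distance below `2ρ²
+ σ² ≤ 9σ²`. This is the enlargement used in the Vitali covering. -/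
theorem box_subset_box {ρ σ : ℝ} (hρ : 0 < ρ) (hσ : 0 < σ) (h : ρ ≤ 2 * σ) {z w : SpaceTime d}
    (hzw : (box ρ z ∩ box σ w).Nonempty) : box ρ z ⊆ box (5 * σ) w := by
  obtain ⟨p, ⟨⟨h1, h2⟩, h3⟩, ⟨h4, h5⟩, h6⟩ := hzw
  have h7 : ρ ^ 2 ≤ 4 * σ ^ 2 := by nlinarith
  have h8 : 0 < σ ^ 2 := by positivity
  rintro v ⟨⟨h9, h10⟩, h11⟩
  rw [Metric.mem_ball] at *
  refine ⟨⟨by nlinarith, by nlinarith⟩, ?_⟩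
  rw [Metric.mem_ball]
  have := dist_triangle4 v.2 z.2 p.2 w.2
  rw [dist_comm z.2] at this
  linarith

/-- The uncentred maximal function over boxes of radius at most `P`. -/
noncomputable def maxFn (P : ℝ) (g : SpaceTime d → ℝ≥0∞) (z : SpaceTime d) : ℝ≥0∞ :=
  ⨆ (ρ : ℝ) (_ : 0 < ρ) (_ : ρ ≤ P) (y : SpaceTime d) (_ : z ∈ box ρ y),
    (volume (box ρ y))⁻¹ * ∫⁻ w in box ρ y, g w

theorem le_maxFn {P ρ : ℝ} (g : SpaceTime d → ℝ≥0∞) {z y : SpaceTime d} (hρ : 0 < ρ) (hP : ρ ≤ P)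
    (hz : z ∈ box ρ y) : (volume (box ρ y))⁻¹ * ∫⁻ w in box ρ y, g w ≤ maxFn P g z :=
  le_iSup_of_le ρ <| le_iSup_of_le hρ <| le_iSup_of_le hP <| le_iSup_of_le y <|
    le_iSup_of_le hz le_rfl

theorem lt_maxFn_iff {P : ℝ} {g : SpaceTime d → ℝ≥0∞} {z : SpaceTime d} {a : ℝ≥0∞} :
    a < maxFn P g z ↔ ∃ ρ, 0 < ρ ∧ ρ ≤ P ∧ ∃ y, z ∈ box ρ y ∧
      a < (volume (box ρ y))⁻¹ * ∫⁻ w in box ρ y, g w := by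
  simp only [maxFn, lt_iSup_iff, exists_prop]

/-- Because the boxes are open and need not be centred at the point, superlevel sets are unions of
open boxes, whatever `g` is. -/
theorem measurable_maxFn (P : ℝ) (g : SpaceTime d → ℝ≥0∞) : Measurable (maxFn P g) := by
  refine measurable_of_Ioi fun a => IsOpen.measurableSet ?_
  have : maxFn P g ⁻¹' Ioi a = ⋃ (ρ : ℝ) (_ : 0 < ρ) (_ : ρ ≤ P) (y : SpaceTime d)
      (_ : a < (volume (box ρ y))⁻¹ * ∫⁻ w in box ρ y, g w), box ρ y := by
    ext z
    simp only [mem_preimage, mem_Ioi, lt_maxFn_iff, mem_iUnion, exists_prop]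
    tauto
  rw [this]
  exact isOpen_iUnion fun ρ => isOpen_iUnion fun _ => isOpen_iUnion fun _ => isOpen_iUnion fun y =>
    isOpen_iUnion fun _ => isOpen_box ρ y

/-- The weak type (1,1) inequality. -/
theorem mul_volume_lt_maxFn_le (P : ℝ) (g : SpaceTime d → ℝ≥0∞) (a : ℝ≥0∞) :
    a * volume {z | a < maxFn P g z} ≤ 5 ^ (d + 2) * ∫⁻ w, g w := by
  set T : Set (SpaceTime d × ℝ) := {p | 0 < p.2 ∧ p.2 ≤ P ∧
    a < (volume (box p.2 p.1))⁻¹ * ∫⁻ w in box p.2 p.1, g w} with hT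
  have hne : ∀ p ∈ T, (box p.2 p.1).Nonempty := fun p hp =>
    nonempty_of_measure_ne_zero (volume_box_ne_zero hp.1 _)
  -- The Vitali selection needs bounded radii; this is what the truncation of the maximal function
  -- at `P` provides.
  obtain ⟨U, hUT, hdisj, hcov⟩ := Vitali.exists_disjoint_subfamily_covering_enlargement
    (fun p : SpaceTime d × ℝ => box p.2 p.1) T (fun p => p.2) 2 one_lt_two
    (fun p hp => hp.1.le) P (fun p hp => hp.2.1) hne
  have hUc : U.Countable := hdisj.countable_of_isOpen (fun p _ => isOpen_box _ _)
    (fun p hp => hne p (hUT hp))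
  have hsub : {z | a < maxFn P g z} ⊆ ⋃ p ∈ U, box (5 * p.2) p.1 := by
    intro z hz
    obtain ⟨ρ, hρ, hρP, y, hzy, hlt⟩ := lt_maxFn_iff.1 hz
    obtain ⟨b, hb, hne', hle⟩ := hcov (y, ρ) ⟨hρ, hρP, hlt⟩
    exact mem_biUnion hb (box_subset_box hρ (hUT hb).1 hle hne' hzy)
  have hvol : ∀ p ∈ U, a * volume (box (5 * p.2) p.1) ≤ 5 ^ (d + 2) * ∫⁻ w in box p.2 p.1, g w := by
    intro p hp
    obtain ⟨h1, -, h3⟩ := hUT hp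
    have h4 : volume (box (5 * p.2) p.1) = 5 ^ (d + 2) * volume (box p.2 p.1) := by
      rw [volume_box (by positivity), volume_box h1, mul_pow, ENNReal.ofReal_mul (by positivity),
        ENNReal.ofReal_pow (by positivity)]
      simp only [ENNReal.ofReal_ofNat]
      ring
    rw [h4, mul_left_comm]
    gcongr
    rw [mul_comm]
    refine (mul_le_mul_right h3.le _).trans_eq ?_
    rw [← mul_assoc, ENNReal.mul_inv_cancel (volume_box_ne_zero h1 _) (volume_box_ne_top h1 _),
      one_mul]
  calc a * volume {z | a < maxFn P g z}
      ≤ a * ∑' p : U, volume (box (5 * (p : SpaceTime d × ℝ).2) (p : SpaceTime d × ℝ).1) := by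
        gcongr
        exact (measure_mono hsub).trans (measure_biUnion_le _ hUc _)
    _ = ∑' p : U, a * volume (box (5 * (p : SpaceTime d × ℝ).2) (p : SpaceTime d × ℝ).1) :=
        ENNReal.tsum_mul_left.symm
    _ ≤ ∑' p : U, 5 ^ (d + 2) * ∫⁻ w in box (p : SpaceTime d × ℝ).2 (p : SpaceTime d × ℝ).1, g w :=
        ENNReal.tsum_le_tsum fun p => hvol p p.2
    _ = 5 ^ (d + 2) * ∫⁻ w in ⋃ p ∈ U, box p.2 p.1, g w := by
        rw [ENNReal.tsum_mul_left, lintegral_biUnion hUc (fun p _ => (isOpen_box _ _).measurableSet)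
          hdisj]
    _ ≤ 5 ^ (d + 2) * ∫⁻ w, g w := by
        gcongr
        exact Measure.restrict_le_self

theorem maxFn_le_of_le {P : ℝ} {g : SpaceTime d → ℝ≥0∞} {B : ℝ≥0∞} (h : ∀ w, g w ≤ B)
    (z : SpaceTime d) : maxFn P g z ≤ B := by
  refine iSup_le fun ρ => iSup_le fun hρ => iSup_le fun _ => iSup_le fun y => iSup_le fun _ => ?_
  calc _ ≤ (volume (box ρ y))⁻¹ * ∫⁻ w in box ρ y, B := by gcongr; exact h _
    _ = (volume (box ρ y))⁻¹ * volume (box ρ y) * B := by rw [setLIntegral_const]; ring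
    _ = B := by
      rw [ENNReal.inv_mul_cancel (volume_box_ne_zero hρ _) (volume_box_ne_top hρ _), one_mul]

theorem maxFn_le_add {P : ℝ} {g h : SpaceTime d → ℝ≥0∞} {B : ℝ≥0∞} (hgh : ∀ w, g w ≤ h w + B)
    (z : SpaceTime d) : maxFn P g z ≤ maxFn P h z + B := by
  refine iSup_le fun ρ => iSup_le fun hρ => iSup_le fun hP => iSup_le fun y => iSup_le fun hy => ?_
  calc _ ≤ (volume (box ρ y))⁻¹ * ∫⁻ w in box ρ y, (h w + B) := by gcongr; exact hgh _
    _ = (volume (box ρ y))⁻¹ * (∫⁻ w in box ρ y, h w) +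
        (volume (box ρ y))⁻¹ * volume (box ρ y) * B := by
        rw [lintegral_add_right _ measurable_const, setLIntegral_const]; ring
    _ ≤ maxFn P h z + B := by
      rw [ENNReal.inv_mul_cancel (volume_box_ne_zero hρ _) (volume_box_ne_top hρ _), one_mul]
      gcongr
      exact le_maxFn h hρ hP hy

/-- Values of `G` up to `l / 2` raise the maximal function by at most `l / 2`, so the weak type
bound is needed only for the part of `G` above `l / 2`. Writing the result with the measure `G dw`
prepares a second use of the layer cake formula. -/
theorem volume_lt_maxFn_le (P : ℝ) {G : SpaceTime d → ℝ} (hG : Measurable G) {l : ℝ} (hl : 0 < l) :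
    volume {z | ENNReal.ofReal l < maxFn P (fun w => ENNReal.ofReal (G w)) z} ≤
      2 * 5 ^ (d + 2) * (ENNReal.ofReal l)⁻¹ *
        (volume.withDensity fun w => ENNReal.ofReal (G w)) {w | l < 2 * G w} := by
  set S : Set (SpaceTime d) := {w | l < 2 * G w}
  have hS : MeasurableSet S := measurableSet_lt measurable_const (hG.const_mul 2)
  have h1 : {z | ENNReal.ofReal l < maxFn P (fun w => ENNReal.ofReal (G w)) z} ⊆
      {z | ENNReal.ofReal (l / 2) < maxFn P (S.indicator fun w => ENNReal.ofReal (G w)) z} := by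
    intro z hz
    have h2 := maxFn_le_add (P := P) (g := fun w => ENNReal.ofReal (G w))
      (h := S.indicator fun w => ENNReal.ofReal (G w)) (B := ENNReal.ofReal (l / 2)) (fun w => by
        by_cases hw : w ∈ S
        · rw [indicator_of_mem hw]; exact le_self_add
        · rw [indicator_of_notMem hw, zero_add]
          refine ENNReal.ofReal_le_ofReal ?_
          have : ¬ l < 2 * G w := hw
          linarith) z
    have h3 := lt_of_lt_of_le hz h2
    nth_rewrite 1 [← add_halves l] at h3
    rw [ENNReal.ofReal_add (by positivity) (by positivity)] at h3
    exact (ENNReal.add_lt_add_iff_right ENNReal.ofReal_ne_top).1 h3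
  have h4 := mul_volume_lt_maxFn_le P (S.indicator fun w => ENNReal.ofReal (G w))
    (ENNReal.ofReal (l / 2))
  rw [lintegral_indicator hS, ← withDensity_apply _ hS] at h4
  have h5 : ENNReal.ofReal l = 2 * ENNReal.ofReal (l / 2) := by
    rw [← ENNReal.ofReal_ofNat, ← ENNReal.ofReal_mul (by norm_num)]; congr 1; ring
  have h6 : ENNReal.ofReal l ≠ 0 := by simpa using hl
  refine (measure_mono h1).trans ?_
  rw [mul_comm _ (ENNReal.ofReal l)⁻¹, mul_assoc, ← ENNReal.mul_le_iff_le_inv h6 ENNReal.ofReal_ne_top,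
    h5, mul_assoc, mul_assoc]
  gcongr

/-- The strong type (q,q) inequality for bounded functions. -/
theorem lintegral_maxFn_rpow_le (P : ℝ) {q : ℝ} (hq : 1 < q) {G : SpaceTime d → ℝ}
    (hG : Measurable G) (hG0 : ∀ w, 0 ≤ G w) {B : ℝ} (hB : ∀ w, G w ≤ B) :
    ∫⁻ z, maxFn P (fun w => ENNReal.ofReal (G w)) z ^ q ≤
      ENNReal.ofReal q * (2 * 5 ^ (d + 2)) * (ENNReal.ofReal (q - 1))⁻¹ *
        ENNReal.ofReal (2 ^ (q - 1)) * ∫⁻ w, ENNReal.ofReal (G w) ^ q := by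
  set g : SpaceTime d → ℝ≥0∞ := fun w => ENNReal.ofReal (G w)
  have hq0 : 0 < q := by linarith
  have hq1 : 0 < q - 1 := by linarith
  have hfin : ∀ z, maxFn P g z ≠ ⊤ := fun z =>
    ne_top_of_le_ne_top ENNReal.ofReal_ne_top
      (maxFn_le_of_le (fun w => ENNReal.ofReal_le_ofReal (hB w)) z)
  have h1 : ∫⁻ z, maxFn P g z ^ q = ∫⁻ z, ENNReal.ofReal ((maxFn P g z).toReal ^ q) := by
    refine lintegral_congr fun z => ?_
    rw [← ENNReal.ofReal_rpow_of_nonneg ENNReal.toReal_nonneg hq0.le, ENNReal.ofReal_toReal (hfin z)]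
  set ν := volume.withDensity g
  -- Layer cake for the measure `G dw` with exponent `q - 1`: the missing power of `G` is the
  -- density. Comparing with layer cake for the maximal function produces the factor `q / (q - 1)`.
  have h2 := lintegral_rpow_eq_lintegral_meas_lt_mul ν (f := fun w => 2 * G w)
    (Filter.Eventually.of_forall fun w => mul_nonneg zero_le_two (hG0 w))
    (hG.const_mul 2).aemeasurable hq1
  have h3 : ∫⁻ w, ENNReal.ofReal ((2 * G w) ^ (q - 1)) ∂ν =
      ENNReal.ofReal (2 ^ (q - 1)) * ∫⁻ w, g w ^ q := by
    rw [lintegral_withDensity_eq_lintegral_mul _ hG.ennreal_ofReal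
      ((hG.const_mul 2).pow_const _).ennreal_ofReal,
      ← lintegral_const_mul _ (hG.ennreal_ofReal.pow_const _)]
    refine lintegral_congr fun w => ?_
    simp only [Pi.mul_apply]
    rw [Real.mul_rpow zero_le_two (hG0 w), ENNReal.ofReal_mul (by positivity), mul_left_comm,
      ENNReal.ofReal_rpow_of_nonneg (hG0 w) hq0.le, ← ENNReal.ofReal_mul (hG0 w)]
    congr 2
    rcases (hG0 w).eq_or_lt with h | h
    · rw [← h, Real.zero_rpow hq0.ne', zero_mul]
    · rw [mul_comm, ← Real.rpow_add_one h.ne']; ring_nf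
  rw [h1, lintegral_rpow_eq_lintegral_meas_lt_mul volume
    (Filter.Eventually.of_forall fun w => ENNReal.toReal_nonneg)
    (measurable_maxFn P g).ennreal_toReal.aemeasurable hq0]
  have h4 : ∫⁻ t in Ioi (0 : ℝ), volume {a | t < (maxFn P g a).toReal} *
      ENNReal.ofReal (t ^ (q - 1)) ≤ ∫⁻ t in Ioi (0 : ℝ), (2 * 5 ^ (d + 2)) *
        (ν {w | t < 2 * G w} * ENNReal.ofReal (t ^ (q - 1 - 1))) := by
    refine setLIntegral_mono' measurableSet_Ioi fun t ht => ?_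
    have ht : 0 < t := ht
    have h5 : {a | t < (maxFn P g a).toReal} = {a | ENNReal.ofReal t < maxFn P g a} := by
      ext a; exact (ENNReal.ofReal_lt_iff_lt_toReal ht.le (hfin a)).symm
    have h6 : ENNReal.ofReal (t ^ (q - 1 - 1)) =
        (ENNReal.ofReal t)⁻¹ * ENNReal.ofReal (t ^ (q - 1)) := by
      rw [← ENNReal.ofReal_inv_of_pos ht, ← ENNReal.ofReal_mul (by positivity),
        Real.rpow_sub_one ht.ne']
      congr 1; field_simp
    rw [h5, h6]
    calc _ ≤ _ := mul_le_mul_left (volume_lt_maxFn_le P hG ht) _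
      _ = _ := by ring
  have h7 : (ENNReal.ofReal (q - 1))⁻¹ * ENNReal.ofReal (q - 1) = 1 :=
    ENNReal.inv_mul_cancel (by simpa using hq1) ENNReal.ofReal_ne_top
  calc _ ≤ ENNReal.ofReal q * ∫⁻ t in Ioi (0 : ℝ), (2 * 5 ^ (d + 2)) *
        (ν {w | t < 2 * G w} * ENNReal.ofReal (t ^ (q - 1 - 1))) := by gcongr
    _ = ENNReal.ofReal q * (2 * 5 ^ (d + 2)) * ((ENNReal.ofReal (q - 1))⁻¹ * ENNReal.ofReal (q - 1)) *
        ∫⁻ t in Ioi (0 : ℝ), ν {w | t < 2 * G w} * ENNReal.ofReal (t ^ (q - 1 - 1)) := by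
        rw [lintegral_const_mul' _ _ (by finiteness), h7]; ring
    _ = ENNReal.ofReal q * (2 * 5 ^ (d + 2)) * (ENNReal.ofReal (q - 1))⁻¹ *
        ∫⁻ w, ENNReal.ofReal ((2 * G w) ^ (q - 1)) ∂ν := by rw [h2]; ring
    _ = _ := by rw [h3]; ring

/-! ### Derivatives and parabolic changes of variables -/

/-- The `i`-th spatial coordinate direction in space-time. -/
noncomputable def spaceDir (i : Fin d) : SpaceTime d := (0, EuclideanSpace.single i 1)

/-- The parabolic dilation by `ρ` followed by the translation by `c`. -/
noncomputable def dil (c : SpaceTime d) (ρ : ℝ) (w : SpaceTime d) : SpaceTime d :=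
  (c.1 + ρ ^ 2 * w.1, c.2 + ρ • w.2)

/-- The base point of the image of `C_R` under the parabolic contraction by `l` towards `z`. -/
noncomputable def shrink (z : SpaceTime d) (l : ℝ) : SpaceTime d :=
  ((1 - l ^ 2) * z.1, (1 - l) • z.2)

theorem spaceDeriv_eq {u : SpaceTime d → ℝ} (hu : ContDiff ℝ ∞ u) (i : Fin d) (z : SpaceTime d) :
    spaceDeriv i u z = fderiv ℝ u z (spaceDir i) := by
  have h1 : HasFDerivAt (fun x : EuclideanSpace ℝ (Fin d) => u (z.1, x))
      ((fderiv ℝ u z).comp (ContinuousLinearMap.inr ℝ ℝ (EuclideanSpace ℝ (Fin d)))) z.2 := by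
    have h2 : HasFDerivAt u (fderiv ℝ u z) (z.1, z.2) :=
      (hu.differentiable (by simp) z).hasFDerivAt
    exact h2.comp z.2 (hasFDerivAt_prodMk_right z.1 z.2)
  rw [spaceDeriv, (h1.hasLineDerivAt _).lineDeriv]
  rfl

theorem timeDeriv_eq {u : SpaceTime d → ℝ} (hu : ContDiff ℝ ∞ u) (z : SpaceTime d) :
    timeDeriv u z = fderiv ℝ u z (1, 0) := by
  have h2 : HasFDerivAt u (fderiv ℝ u z) (z.1, z.2) :=
    (hu.differentiable (by simp) z).hasFDerivAt
  have h1 : HasDerivAt (fun s : ℝ => u (s, z.2)) (fderiv ℝ u z (1, 0)) z.1 :=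
    h2.comp_hasDerivAt z.1 ((hasDerivAt_id z.1).prodMk (hasDerivAt_const z.1 z.2))
  exact h1.deriv

theorem contDiff_fderiv_apply {u : SpaceTime d → ℝ} (hu : ContDiff ℝ ∞ u) (v : SpaceTime d) :
    ContDiff ℝ ∞ fun z => fderiv ℝ u z v :=
  (hu.fderiv_right (m := ∞) (by simp)).clm_apply contDiff_const

theorem contDiff_spaceDeriv {u : SpaceTime d → ℝ} (hu : ContDiff ℝ ∞ u) (i : Fin d) :
    ContDiff ℝ ∞ (spaceDeriv i u) := by
  rw [show spaceDeriv i u = _ from funext (spaceDeriv_eq hu i)]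
  exact contDiff_fderiv_apply hu _

theorem contDiff_timeDeriv {u : SpaceTime d → ℝ} (hu : ContDiff ℝ ∞ u) :
    ContDiff ℝ ∞ (timeDeriv u) := by
  rw [show timeDeriv u = _ from funext (timeDeriv_eq hu)]
  exact contDiff_fderiv_apply hu _

/-- Symmetry of the second derivative puts `∂_t D_i u` in the form `D_i ∂_t u`, whose spatial
derivative can be moved onto the bump function. -/
theorem fderiv_spaceDeriv_time {u : SpaceTime d → ℝ} (hu : ContDiff ℝ ∞ u) (i : Fin d)
    (z : SpaceTime d) :
    fderiv ℝ (spaceDeriv i u) z (1, 0) = fderiv ℝ (timeDeriv u) z (spaceDir i) := by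
  rw [show spaceDeriv i u = _ from funext (spaceDeriv_eq hu i),
    show timeDeriv u = _ from funext (timeDeriv_eq hu)]
  have hd : DifferentiableAt ℝ (fderiv ℝ u) z :=
    (hu.fderiv_right (m := ∞) (by simp)).differentiable (by simp) z
  rw [fderiv_clm_apply hd (by fun_prop), fderiv_clm_apply hd (by fun_prop)]
  simpa using ((contDiff_infty.1 hu 2).contDiffAt.isSymmSndFDerivAt (by simp)).eq (1, 0) (spaceDir i)

theorem hasFDerivAt_dil (c : SpaceTime d) (ρ : ℝ) (w : SpaceTime d) :
    HasFDerivAt (dil c ρ) ((ρ ^ 2 • ContinuousLinearMap.fst ℝ ℝ (EuclideanSpace ℝ (Fin d))).prod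
      (ρ • ContinuousLinearMap.snd ℝ ℝ (EuclideanSpace ℝ (Fin d)))) w :=
  ((hasFDerivAt_fst.const_mul (ρ ^ 2)).const_add c.1).prodMk
    ((hasFDerivAt_snd.const_smul ρ).const_add c.2)

theorem contDiff_dil (c : SpaceTime d) (ρ : ℝ) : ContDiff ℝ ∞ (dil c ρ) := by
  unfold dil; fun_prop

theorem measurable_dil (c : SpaceTime d) (ρ : ℝ) : Measurable (dil c ρ) :=
  (contDiff_dil c ρ).continuous.measurable

theorem fderiv_comp_dil {h : SpaceTime d → ℝ} (hh : ContDiff ℝ ∞ h) (c : SpaceTime d) (ρ : ℝ)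
    (w : SpaceTime d) (i : Fin d) :
    fderiv ℝ (fun w => h (dil c ρ w)) w (spaceDir i) = ρ * fderiv ℝ h (dil c ρ w) (spaceDir i) := by
  have h1 := ((hh.differentiable (by simp) (dil c ρ w)).hasFDerivAt).comp w (hasFDerivAt_dil c ρ w)
  rw [show (fun w => h (dil c ρ w)) = h ∘ dil c ρ from rfl, h1.fderiv, ← smul_eq_mul, ← map_smul]
  simp [spaceDir]

/-- Integration by parts in space after a parabolic change of variables. -/
theorem integral_mul_fderiv_dil {ψ h : SpaceTime d → ℝ} (hψ : ContDiff ℝ ∞ ψ)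
    (hψc : HasCompactSupport ψ) (hh : ContDiff ℝ ∞ h) (c : SpaceTime d) (ρ : ℝ) (i : Fin d) :
    ∫ w, ψ w * (ρ * fderiv ℝ h (dil c ρ w) (spaceDir i)) =
      -∫ w, fderiv ℝ ψ w (spaceDir i) * h (dil c ρ w) := by
  have hg : ContDiff ℝ ∞ fun w => h (dil c ρ w) := hh.comp (contDiff_dil c ρ)
  have hdψ := contDiff_fderiv_apply hψ (spaceDir i)
  have hdg := contDiff_fderiv_apply hg (spaceDir i)
  have : (volume : Measure (SpaceTime d)).IsAddHaarMeasure :=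
    inferInstanceAs ((volume : Measure ℝ).prod
      (volume : Measure (EuclideanSpace ℝ (Fin d)))).IsAddHaarMeasure
  have := integral_mul_fderiv_eq_neg_fderiv_mul_of_integrable (μ := volume) (𝕜 := ℝ)
    (f := ψ) (g := fun w => h (dil c ρ w)) (v := spaceDir i)
    ((hdψ.continuous.mul hg.continuous).integrable_of_hasCompactSupport
      (hψc.fderiv_apply (𝕜 := ℝ) _).mul_right)
    ((hψ.continuous.mul hdg.continuous).integrable_of_hasCompactSupport hψc.mul_right)
    ((hψ.continuous.mul hg.continuous).integrable_of_hasCompactSupport hψc.mul_right)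
    (fun x _ => hψ.differentiable (by simp) x) (fun x _ => hg.differentiable (by simp) x)
  rw [← this]
  simp_rw [fderiv_comp_dil hh]

theorem map_dil_volume (c : SpaceTime d) {ρ : ℝ} (hρ : 0 < ρ) :
    Measure.map (dil c ρ) volume = (ENNReal.ofReal (ρ ^ (d + 2)))⁻¹ • volume := by
  have h1 : Measure.map (fun s : ℝ => c.1 + ρ ^ 2 * s) volume =
      ENNReal.ofReal (ρ ^ 2)⁻¹ • volume := by
    rw [show (fun s : ℝ => c.1 + ρ ^ 2 * s) = (fun s => c.1 + s) ∘ (fun s => ρ ^ 2 • s) from rfl,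
      ← Measure.map_map (by fun_prop) (by fun_prop), Measure.map_addHaar_smul _ (by positivity),
      Measure.map_smul, (measurePreserving_add_left volume c.1).map_eq]
    rw [abs_of_pos (by positivity)]
    simp
  have h2 : Measure.map (fun x : EuclideanSpace ℝ (Fin d) => c.2 + ρ • x) volume =
      ENNReal.ofReal (ρ ^ d)⁻¹ • volume := by
    rw [show (fun x : EuclideanSpace ℝ (Fin d) => c.2 + ρ • x) =
        (fun x => c.2 + x) ∘ (fun x => ρ • x) from rfl,
      ← Measure.map_map (by fun_prop) (by fun_prop), Measure.map_addHaar_smul _ (by positivity),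
      Measure.map_smul, (measurePreserving_add_left volume c.2).map_eq]
    rw [abs_of_pos (by positivity)]
    simp
  have h3 : dil c ρ = Prod.map (fun s : ℝ => c.1 + ρ ^ 2 * s)
      (fun x : EuclideanSpace ℝ (Fin d) => c.2 + ρ • x) := rfl
  rw [h3, Measure.volume_eq_prod, ← Measure.map_prod_map _ _ (by fun_prop) (by fun_prop), h1, h2,
    Measure.prod_smul_left, Measure.prod_smul_right, smul_smul, ← ENNReal.ofReal_mul (by positivity),
    ← ENNReal.ofReal_inv_of_pos (by positivity)]
  congr 2
  rw [← mul_inv]; ring_nf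

theorem preimage_dil_cylinder (c : SpaceTime d) {ρ : ℝ} (hρ : 0 < ρ) :
    dil c ρ ⁻¹' cylinder (ENNReal.ofReal ρ) c = cylinder (ENNReal.ofReal 1) 0 := by
  have h2 : 0 < ρ ^ 2 := by positivity
  ext w
  rw [mem_preimage, mem_cylinder_ofReal hρ, mem_cylinder_ofReal one_pos]
  simp only [dil, sub_add_cancel_left, norm_neg, norm_smul, Real.norm_eq_abs, abs_of_pos hρ,
    le_add_iff_nonneg_right, add_lt_add_iff_left, Prod.fst_zero, Prod.snd_zero, zero_sub, zero_add,
    one_pow]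
  rw [mul_lt_iff_lt_one_right hρ, mul_nonneg_iff_of_pos_left h2, mul_lt_iff_lt_one_right h2]

/-- Change of variables from the unit cylinder. -/
theorem setLIntegral_comp_dil (c : SpaceTime d) {ρ : ℝ} (hρ : 0 < ρ) {F : SpaceTime d → ℝ≥0∞}
    (hF : Measurable F) :
    ∫⁻ w in cylinder (ENNReal.ofReal 1) 0, F (dil c ρ w) =
      unitVol d * ⨍⁻ w in cylinder (ENNReal.ofReal ρ) c, F w ∂volume := by
  rw [← preimage_dil_cylinder c hρ, ← setLIntegral_map (measurableSet_cylinder_ofReal hρ c) hF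
    (measurable_dil c ρ), map_dil_volume c hρ, Measure.restrict_smul, lintegral_smul_measure,
    setLAverage_eq, volume_cylinder hρ, smul_eq_mul, div_eq_mul_inv,
    ENNReal.mul_inv (Or.inr unitVol_ne_top) (Or.inl ENNReal.ofReal_ne_top)]
  calc _ = unitVol d * (unitVol d)⁻¹ * ((ENNReal.ofReal (ρ ^ (d + 2)))⁻¹ *
        ∫⁻ w in cylinder (ENNReal.ofReal ρ) c, F w) := by
        rw [ENNReal.mul_inv_cancel unitVol_ne_zero unitVol_ne_top, one_mul]
    _ = _ := by ring

/-! ### The integral representation and the pointwise gradient bound -/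

/-- A smooth bump function in the unit cylinder. -/
theorem exists_bump (d : ℕ) : ∃ φ : SpaceTime d → ℝ, ContDiff ℝ ∞ φ ∧ HasCompactSupport φ ∧
    tsupport φ ⊆ cylinder (ENNReal.ofReal 1) 0 ∧ ∫ w, φ w = 1 := by
  -- Centring at time `1/2` keeps the closed support away from the bottom and top faces of the
  -- half-open cylinder.
  let f : ContDiffBump ((1 / 2, 0) : SpaceTime d) := ⟨1 / 8, 1 / 4, by norm_num, by norm_num⟩
  refine ⟨f.normed volume, f.contDiff_normed, f.hasCompactSupport_normed, ?_, f.integral_normed⟩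
  rw [f.tsupport_normed_eq, cylinder_ofReal_eq one_pos]
  intro w hw
  rw [Metric.mem_closedBall, Prod.dist_eq, max_le_iff, Real.dist_eq, abs_le] at hw
  obtain ⟨⟨h1, h2⟩, h3⟩ := hw
  change dist w.2 0 ≤ 1 / 4 at h3
  change -(1 / 4) ≤ w.1 - 1 / 2 at h1
  change w.1 - 1 / 2 ≤ 1 / 4 at h2
  refine ⟨⟨?_, ?_⟩, ?_⟩
  · change 0 ≤ w.1; linarith
  · change w.1 < 0 + 1 ^ 2; linarith
  · rw [Metric.mem_ball]; exact lt_of_le_of_lt h3 (by norm_num)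

/-- The left side is the inner product of `a` with one column of the Hessian, whose length is at
most the Frobenius norm. -/
theorem norm_fderiv_spaceDeriv_le {u : SpaceTime d → ℝ} (hu : ContDiff ℝ ∞ u) (i : Fin d)
    (z : SpaceTime d) (a : EuclideanSpace ℝ (Fin d)) :
    |fderiv ℝ (spaceDeriv i u) z (0, a)| ≤ ‖a‖ * ‖spaceHess u z‖ := by
  set b : EuclideanSpace ℝ (Fin d) := WithLp.toLp 2 fun j => spaceDeriv j (spaceDeriv i u) z
  have h1 : fderiv ℝ (spaceDeriv i u) z (0, a) = inner ℝ a b := by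
    have h2 : ((0 : ℝ), a) = ∑ j, a j • spaceDir j := by
      have h3 : a = ∑ j, a j • EuclideanSpace.single j (1 : ℝ) := by
        ext k; simp [Finset.sum_apply, Pi.single_apply]
      refine Prod.ext ?_ ?_
      · simp [spaceDir, Prod.fst_sum]
      · simp only [spaceDir, Prod.snd_sum, Prod.smul_snd]
        exact h3
    rw [h2, map_sum, PiLp.inner_apply]
    refine Finset.sum_congr rfl fun j _ => ?_
    rw [map_smul, ← spaceDeriv_eq (contDiff_spaceDeriv hu i)]
    simp [b, mul_comm]
  have h4 : ‖b‖ ≤ ‖spaceHess u z‖ := by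
    rw [EuclideanSpace.norm_eq, EuclideanSpace.norm_eq, Fintype.sum_prod_type]
    refine Real.sqrt_le_sqrt (Finset.sum_le_sum fun j _ => ?_)
    exact Finset.single_le_sum (f := fun k => ‖spaceHess u z (j, k)‖ ^ 2)
      (fun _ _ => sq_nonneg _) (Finset.mem_univ i)
  rw [h1]
  exact (abs_real_inner_le_norm a b).trans (by gcongr)

theorem hasDerivAt_dil_shrink (R : ℝ) (z w : SpaceTime d) (l : ℝ) :
    HasDerivAt (fun l => dil (shrink z l) (l * R) w)
      (2 * l * (R ^ 2 * w.1 - z.1), R • w.2 - z.2) l := by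
  have h1 : HasDerivAt (fun l : ℝ => (1 - l ^ 2) * z.1 + (l * R) ^ 2 * w.1)
      (2 * l * (R ^ 2 * w.1 - z.1)) l := by
    have := (((hasDerivAt_pow 2 l).const_sub 1).mul_const z.1).add
      ((((hasDerivAt_id l).mul_const R).pow 2).mul_const w.1)
    refine this.congr_deriv ?_
    simp only [id, Nat.cast_ofNat, Nat.add_one_sub_one, pow_one]
    ring
  have h2 : HasDerivAt (fun l : ℝ => (1 - l) • z.2 + (l * R) • w.2) (R • w.2 - z.2) l := by
    have := (((hasDerivAt_id l).const_sub 1).smul_const z.2).add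
      (((hasDerivAt_id l).mul_const R).smul_const w.2)
    refine this.congr_deriv ?_
    rw [neg_one_smul, one_mul, sub_eq_neg_add]
  exact h1.prodMk h2

theorem shrink_zero_dil (R : ℝ) (z w : SpaceTime d) : dil (shrink z 0) (0 * R) w = z := by
  simp [dil, shrink]

theorem shrink_one (z : SpaceTime d) : shrink z 1 = 0 := by
  simp [shrink]

/-- A representation of a function by a weighted average over a cylinder and a weighted integral
of its derivatives along the contractions towards a point. -/
theorem eq_integral_sub_integral {φ v : SpaceTime d → ℝ} (hφ : ContDiff ℝ ∞ φ)
    (hφc : HasCompactSupport φ) (hφ1 : ∫ w, φ w = 1) (hv : ContDiff ℝ ∞ v) (R : ℝ)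
    (z : SpaceTime d) :
    v z = (∫ w, φ w * v (dil 0 R w)) - ∫ l in (0 : ℝ)..1, ∫ w, φ w *
      fderiv ℝ v (dil (shrink z l) (l * R) w) (2 * l * (R ^ 2 * w.1 - z.1), R • w.2 - z.2) := by
  set G : ℝ → SpaceTime d → ℝ := fun l w =>
    fderiv ℝ v (dil (shrink z l) (l * R) w) (2 * l * (R ^ 2 * w.1 - z.1), R • w.2 - z.2) with hG
  have hGc : Continuous (Function.uncurry G) := by
    have h1 : Continuous (fderiv ℝ v) := hv.continuous_fderiv (by simp)
    refine (h1.comp (f := fun p : ℝ × SpaceTime d => dil (shrink z p.1) (p.1 * R) p.2)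
      ?_).clm_apply ?_
    · unfold dil shrink; fun_prop
    · fun_prop
  -- The path `l ↦ dil (shrink z l) (l * R) w` runs from `z` at `l = 0` to `dil 0 R w` at `l = 1`.
  have hftc : ∀ w, ∫ l in (0 : ℝ)..1, G l w = v (dil 0 R w) - v z := by
    intro w
    have h1 : ∀ l ∈ uIcc (0 : ℝ) 1, HasDerivAt (fun l => v (dil (shrink z l) (l * R) w)) (G l w) l :=
      fun l _ => (hv.differentiable (by simp) _).hasFDerivAt.comp_hasDerivAt l
        (hasDerivAt_dil_shrink R z w l)
    rw [intervalIntegral.integral_eq_sub_of_hasDerivAt h1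
      ((hGc.comp (by fun_prop : Continuous fun l : ℝ => (l, w))).intervalIntegrable _ _)]
    rw [shrink_zero_dil, shrink_one, one_mul]
  have hint : Integrable (Function.uncurry fun l w => φ w * G l w)
      ((volume.restrict (uIoc (0 : ℝ) 1)).prod volume) := by
    have hc : Continuous (Function.uncurry fun l w => φ w * G l w) :=
      (hφ.continuous.comp continuous_snd).mul hGc
    have h1 : IntegrableOn (Function.uncurry fun l w => φ w * G l w)
        (Icc (0 : ℝ) 1 ×ˢ tsupport φ) (volume.prod volume) :=
      hc.continuousOn.integrableOn_compact (isCompact_Icc.prod hφc)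
    have h2 : IntegrableOn (Function.uncurry fun l w => φ w * G l w)
        (Icc (0 : ℝ) 1 ×ˢ univ) (volume.prod volume) := by
      refine h1.of_forall_sdiff_eq_zero (measurableSet_Icc.prod MeasurableSet.univ) ?_
      rintro ⟨l, w⟩ ⟨hl, hw⟩
      have : w ∉ tsupport φ := fun h => hw ⟨hl.1, h⟩
      simp [Function.uncurry, image_eq_zero_of_notMem_tsupport this]
    have h3 := h2.mono_set (t := Icc (0 : ℝ) 1 ×ˢ univ) (s := uIoc (0 : ℝ) 1 ×ˢ univ)
      (prod_mono (by rw [uIoc_of_le zero_le_one]; exact Ioc_subset_Icc_self) subset_rfl)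
    rwa [IntegrableOn, ← Measure.prod_restrict, Measure.restrict_univ] at h3
  rw [intervalIntegral_integral_swap hint]
  simp_rw [intervalIntegral.integral_const_mul, hftc]
  have hi : Integrable fun w => φ w * v (dil 0 R w) :=
    (hφ.continuous.mul (hv.continuous.comp
      (contDiff_dil 0 R).continuous)).integrable_of_hasCompactSupport hφc.mul_right
  have hi' : Integrable fun w => φ w * v z :=
    (hφ.continuous.mul continuous_const).integrable_of_hasCompactSupport hφc.mul_right
  simp_rw [mul_sub]
  rw [integral_sub hi hi', integral_mul_const, hφ1]
  ring

/-- Moving the spatial derivative off `∂_t u` costs `1 / (lR)`. The time component of the velocity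
carries a factor `2l`, a consequence of parabolic scaling, so the singularity at `l = 0` cancels and
`2 / R` remains. -/
theorem integral_mul_fderiv_spaceDeriv {φ u : SpaceTime d → ℝ} (hφ : ContDiff ℝ ∞ φ)
    (hφc : HasCompactSupport φ) (hu : ContDiff ℝ ∞ u) {R : ℝ} (hR : 0 < R) (i : Fin d)
    (z c : SpaceTime d) (l : ℝ) :
    ∫ w, φ w * fderiv ℝ (spaceDeriv i u) (dil c (l * R) w)
        (2 * l * (R ^ 2 * w.1 - z.1), R • w.2 - z.2) =
      ∫ w, (φ w * fderiv ℝ (spaceDeriv i u) (dil c (l * R) w) (0, R • w.2 - z.2) -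
        2 / R * (R ^ 2 * w.1 - z.1) * fderiv ℝ φ w (spaceDir i) *
          timeDeriv u (dil c (l * R) w)) := by
  -- Chosen so that `ψ * (l * R)` is `φ` times the time velocity. The prefactor depends on time
  -- only, so a spatial derivative of `ψ` falls on `φ` alone.
  set ψ : SpaceTime d → ℝ := fun w => 2 / R * (R ^ 2 * w.1 - z.1) * φ w with hψdef
  have hp : ContDiff ℝ ∞ fun w : SpaceTime d => 2 / R * (R ^ 2 * w.1 - z.1) := by fun_prop
  have hψ : ContDiff ℝ ∞ ψ := hp.mul hφ
  have hψc : HasCompactSupport ψ := hφc.mul_left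
  have hdψ : ∀ w, fderiv ℝ ψ w (spaceDir i) =
      2 / R * (R ^ 2 * w.1 - z.1) * fderiv ℝ φ w (spaceDir i) := by
    intro w
    have h1 : HasFDerivAt (fun w : SpaceTime d => 2 / R * (R ^ 2 * w.1 - z.1))
        ((2 / R) • (R ^ 2 • ContinuousLinearMap.fst ℝ ℝ (EuclideanSpace ℝ (Fin d)))) w :=
      ((hasFDerivAt_fst.const_mul (R ^ 2)).sub_const z.1).const_mul (2 / R)
    have h2 := h1.mul (hφ.differentiable (by simp) w).hasFDerivAt
    rw [show ψ = _ from rfl]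
    erw [h2.fderiv]
    simp [spaceDir]
  have hh := contDiff_timeDeriv hu
  have hv := contDiff_spaceDeriv hu i
  have hcd := (contDiff_dil c (l * R)).continuous
  have ibp := integral_mul_fderiv_dil hψ hψc hh c (l * R) i
  have e1 : ∀ w, φ w * fderiv ℝ (spaceDeriv i u) (dil c (l * R) w)
        (2 * l * (R ^ 2 * w.1 - z.1), R • w.2 - z.2) =
      φ w * fderiv ℝ (spaceDeriv i u) (dil c (l * R) w) (0, R • w.2 - z.2) +
      ψ w * (l * R * fderiv ℝ (timeDeriv u) (dil c (l * R) w) (spaceDir i)) := by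
    intro w
    have e2 : ((2 * l * (R ^ 2 * w.1 - z.1), R • w.2 - z.2) : SpaceTime d) =
        (2 * l * (R ^ 2 * w.1 - z.1)) • (1, 0) + (0, R • w.2 - z.2) := by simp
    rw [e2, map_add, map_smul, fderiv_spaceDeriv_time hu, smul_eq_mul, hψdef]
    field_simp
    ring
  have i1 : Integrable fun w =>
      φ w * fderiv ℝ (spaceDeriv i u) (dil c (l * R) w) (0, R • w.2 - z.2) := by
    refine (hφ.continuous.mul ?_).integrable_of_hasCompactSupport hφc.mul_right
    exact ((hv.continuous_fderiv (by simp)).comp hcd).clm_apply (by fun_prop)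
  have i2 : Integrable fun w =>
      ψ w * (l * R * fderiv ℝ (timeDeriv u) (dil c (l * R) w) (spaceDir i)) := by
    refine (hψ.continuous.mul ?_).integrable_of_hasCompactSupport hψc.mul_right
    exact continuous_const.mul
      (((hh.continuous_fderiv (by simp)).comp hcd).clm_apply continuous_const)
  have i3 : Integrable fun w =>
      fderiv ℝ ψ w (spaceDir i) * timeDeriv u (dil c (l * R) w) :=
    ((contDiff_fderiv_apply hψ _).continuous.mul
      (hh.continuous.comp hcd)).integrable_of_hasCompactSupport
      (hψc.fderiv_apply (𝕜 := ℝ) _).mul_right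
  simp_rw [e1]
  rw [integral_add i1 i2, ibp, ← sub_eq_add_neg, ← integral_sub i1 i3]
  simp_rw [hdψ]

/-- For points of these cylinders, `|R² w.1 - z.1| ≤ R²` and `‖R w.2 - z.2‖ ≤ 2R`; after the factor
`2 / R`, both terms are of order `R`. -/
theorem abs_integrand_le {φ u : SpaceTime d → ℝ} (hu : ContDiff ℝ ∞ u) {K R : ℝ} (hR : 0 < R)
    (i : Fin d) (hK : ∀ w, |φ w| ≤ K) (hK' : ∀ w, |fderiv ℝ φ w (spaceDir i)| ≤ K)
    {z w p : SpaceTime d} (hz : z ∈ cylinder (ENNReal.ofReal R) 0)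
    (hw : w ∈ cylinder (ENNReal.ofReal 1) 0) :
    |φ w * fderiv ℝ (spaceDeriv i u) p (0, R • w.2 - z.2) -
        2 / R * (R ^ 2 * w.1 - z.1) * fderiv ℝ φ w (spaceDir i) * timeDeriv u p| ≤
      2 * K * R * (|timeDeriv u p| + ‖spaceHess u p‖) := by
  rw [mem_cylinder_ofReal hR] at hz
  rw [mem_cylinder_ofReal one_pos] at hw
  simp only [Prod.snd_zero, zero_sub, norm_neg, Prod.fst_zero, zero_add, one_pow] at hz hw
  have hK0 : 0 ≤ K := (abs_nonneg _).trans (hK w)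
  have hR2 : 0 < R ^ 2 := by positivity
  have h1 : |R ^ 2 * w.1 - z.1| ≤ R ^ 2 := by
    rw [abs_le]; constructor <;> nlinarith [hz.2.1, hz.2.2, hw.2.1, hw.2.2]
  have h2 : ‖R • w.2 - z.2‖ ≤ 2 * R := by
    refine (norm_sub_le _ _).trans ?_
    rw [norm_smul, Real.norm_eq_abs, abs_of_pos hR]
    nlinarith [hz.1, hw.1]
  have h3 := norm_fderiv_spaceDeriv_le hu i p (R • w.2 - z.2)
  have h4 : |φ w * fderiv ℝ (spaceDeriv i u) p (0, R • w.2 - z.2)| ≤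
      K * (2 * R * ‖spaceHess u p‖) := by
    rw [abs_mul]
    exact mul_le_mul (hK w) (h3.trans (by gcongr)) (abs_nonneg _) hK0
  have h5 : |2 / R * (R ^ 2 * w.1 - z.1) * fderiv ℝ φ w (spaceDir i) * timeDeriv u p| ≤
      2 / R * R ^ 2 * K * |timeDeriv u p| := by
    rw [abs_mul, abs_mul, abs_mul, abs_of_pos (by positivity : 0 < 2 / R)]
    gcongr
    exact hK' w
  have h6 : 2 / R * R ^ 2 = 2 * R := by field_simp
  rw [h6] at h5
  calc _ ≤ _ := abs_sub _ _
    _ ≤ _ := add_le_add h4 h5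
    _ = _ := by ring

theorem continuous_timeDeriv_add_hess {u : SpaceTime d → ℝ} (hu : ContDiff ℝ ∞ u) :
    Continuous fun p => |timeDeriv u p| + ‖spaceHess u p‖ := by
  refine (contDiff_timeDeriv hu).continuous.abs.add (Continuous.norm ?_)
  refine (PiLp.continuous_toLp 2 _).comp (continuous_pi fun ij => ?_)
  exact (contDiff_spaceDeriv (contDiff_spaceDeriv hu ij.2) ij.1).continuous

/-- A pointwise bound for one spatial derivative. -/
theorem enorm_spaceDeriv_le {φ u : SpaceTime d → ℝ} (hφ : ContDiff ℝ ∞ φ)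
    (hφc : HasCompactSupport φ) (hφs : tsupport φ ⊆ cylinder (ENNReal.ofReal 1) 0)
    (hφ1 : ∫ w, φ w = 1) (hu : ContDiff ℝ ∞ u) {K R : ℝ} (hR : 0 < R) (i : Fin d)
    (hK : ∀ w, |φ w| ≤ K) (hK' : ∀ w, |fderiv ℝ φ w (spaceDir i)| ≤ K)
    {z : SpaceTime d} (hz : z ∈ cylinder (ENNReal.ofReal R) 0) :
    ‖spaceDeriv i u z‖ₑ ≤
      ENNReal.ofReal (K / R) *
        (unitVol d * ⨍⁻ w in cylinder (ENNReal.ofReal R) 0, ‖u w‖ₑ ∂volume) +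
      ENNReal.ofReal (2 * K * R) * (unitVol d * ∫⁻ l in Ioc (0 : ℝ) 1,
        ⨍⁻ w in cylinder (ENNReal.ofReal (l * R)) (shrink z l),
          ENNReal.ofReal (|timeDeriv u w| + ‖spaceHess u w‖) ∂volume) := by
  have hK0 : 0 ≤ K := (abs_nonneg _).trans (hK z)
  have hv := contDiff_spaceDeriv hu i
  have hφ0 : ∀ w ∉ cylinder (ENNReal.ofReal 1) 0, φ w = 0 := fun w hw =>
    image_eq_zero_of_notMem_tsupport fun h => hw (hφs h)
  have hdφ0 : ∀ w ∉ cylinder (ENNReal.ofReal 1) 0, fderiv ℝ φ w (spaceDir i) = 0 := fun w hw => by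
    rw [image_eq_zero_of_notMem_tsupport fun h => hw (hφs (tsupport_fderiv_subset ℝ h))]
    rfl
  have hrep := eq_integral_sub_integral hφ hφc hφ1 hv R z
  simp_rw [integral_mul_fderiv_spaceDeriv hφ hφc hu hR i z] at hrep
  -- The endpoint term `l = 1` is integrated by parts as well, so that it involves `u` in place of
  -- `D_i u`, at the cost of `R⁻¹`.
  have hbdry : ∫ w, φ w * spaceDeriv i u (dil 0 R w) =
      -∫ w, R⁻¹ * fderiv ℝ φ w (spaceDir i) * u (dil 0 R w) := by
    have h := integral_mul_fderiv_dil hφ hφc hu 0 R i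
    simp_rw [mul_assoc]
    rw [integral_const_mul, ← mul_neg, ← h, ← integral_const_mul]
    refine integral_congr_ae (Filter.Eventually.of_forall fun w => ?_)
    simp only [spaceDeriv_eq hu]
    field_simp
  have hm1 := measurableSet_cylinder_ofReal one_pos (0 : SpaceTime d)
  have hB : ‖∫ w, φ w * spaceDeriv i u (dil 0 R w)‖ₑ ≤ ENNReal.ofReal (K / R) *
        (unitVol d * ⨍⁻ w in cylinder (ENNReal.ofReal R) 0, ‖u w‖ₑ ∂volume) := by
    rw [hbdry, enorm_neg, ← setLIntegral_comp_dil 0 hR hu.continuous.measurable.enorm,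
      ← lintegral_const_mul _ (by
        exact (hu.continuous.measurable.comp (measurable_dil 0 R)).enorm),
      ← lintegral_indicator hm1]
    refine (enorm_integral_le_lintegral_enorm _).trans (lintegral_mono fun w => ?_)
    by_cases hw : w ∈ cylinder (ENNReal.ofReal 1) 0
    · rw [indicator_of_mem hw, enorm_mul]
      gcongr
      rw [Real.enorm_eq_ofReal_abs]
      refine ENNReal.ofReal_le_ofReal ?_
      rw [abs_mul, abs_of_pos (by positivity : 0 < R⁻¹), div_eq_inv_mul]
      gcongr
      exact hK' w
    · simp [hdφ0 w hw]
  have hJ : ∀ l ∈ Ioc (0 : ℝ) 1, ‖∫ w, (φ w * fderiv ℝ (spaceDeriv i u)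
        (dil (shrink z l) (l * R) w) (0, R • w.2 - z.2) -
        2 / R * (R ^ 2 * w.1 - z.1) * fderiv ℝ φ w (spaceDir i) *
          timeDeriv u (dil (shrink z l) (l * R) w))‖ₑ ≤
      ENNReal.ofReal (2 * K * R) * (unitVol d *
        ⨍⁻ w in cylinder (ENNReal.ofReal (l * R)) (shrink z l),
          ENNReal.ofReal (|timeDeriv u w| + ‖spaceHess u w‖) ∂volume) := by
    intro l hl
    have hmf := (continuous_timeDeriv_add_hess hu).measurable.ennreal_ofReal
    rw [← setLIntegral_comp_dil _ (mul_pos hl.1 hR) hmf,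
      ← lintegral_const_mul _ (by exact hmf.comp (measurable_dil _ _)),
      ← lintegral_indicator hm1]
    refine (enorm_integral_le_lintegral_enorm _).trans (lintegral_mono fun w => ?_)
    by_cases hw : w ∈ cylinder (ENNReal.ofReal 1) 0
    · rw [indicator_of_mem hw, Real.enorm_eq_ofReal_abs, ← ENNReal.ofReal_mul (by positivity)]
      exact ENNReal.ofReal_le_ofReal (abs_integrand_le hu hR i hK hK' hz hw)
    · simp [hdφ0 w hw, hφ0 w hw]
  have hconst : ENNReal.ofReal (2 * K * R) * unitVol d ≠ ⊤ :=
    ENNReal.mul_ne_top ENNReal.ofReal_ne_top unitVol_ne_top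
  rw [hrep]
  refine (enorm_sub_le).trans (add_le_add hB ?_)
  rw [intervalIntegral.integral_of_le zero_le_one, ← mul_assoc, ← lintegral_const_mul' _ _ hconst]
  refine (enorm_integral_le_lintegral_enorm _).trans
    (setLIntegral_mono' measurableSet_Ioc fun l hl => ?_)
  rw [mul_assoc]
  exact hJ l hl

theorem enorm_toLp_le_sum (x : Fin d → ℝ) :
    ‖(WithLp.toLp 2 x : EuclideanSpace ℝ (Fin d))‖ₑ ≤ ∑ i, ‖x i‖ₑ := by
  have h : (WithLp.toLp 2 x : EuclideanSpace ℝ (Fin d)) =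
      ∑ i, x i • EuclideanSpace.single i (1 : ℝ) := by
    ext k; simp [Finset.sum_apply, Pi.single_apply]
  rw [h]
  refine (enorm_sum_le _ _).trans (Finset.sum_le_sum fun i _ => ?_)
  rw [enorm_smul]
  simp [enorm_eq_nnnorm]

/-- A pointwise bound for the spatial gradient. -/
theorem exists_enorm_spaceGrad_le (d : ℕ) : ∃ K : ℝ≥0, ∀ (R : ℝ), 0 < R →
    ∀ u : SpaceTime d → ℝ, ContDiff ℝ ∞ u → ∀ z ∈ cylinder (ENNReal.ofReal R) 0,
    ‖spaceGrad u z‖ₑ ≤ K *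
      ((ENNReal.ofReal R)⁻¹ * (⨍⁻ w in cylinder (ENNReal.ofReal R) 0, ‖u w‖ₑ ∂volume) +
      ENNReal.ofReal R * ∫⁻ l in Ioc (0 : ℝ) 1,
        ⨍⁻ w in cylinder (ENNReal.ofReal (l * R)) (shrink z l),
          ENNReal.ofReal (|timeDeriv u w| + ‖spaceHess u w‖) ∂volume) := by
  obtain ⟨φ, hφ, hφc, hφs, hφ1⟩ := exists_bump d
  obtain ⟨K₁, hK₁⟩ := hφ.continuous.bounded_above_of_compact_support hφc
  obtain ⟨K₂, hK₂⟩ := (hφ.continuous_fderiv (by simp)).bounded_above_of_compact_support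
    (hφc.fderiv (𝕜 := ℝ))
  set K := max K₁ K₂ with hKdef
  have hK : ∀ w, |φ w| ≤ K := fun w => (hK₁ w).trans (le_max_left _ _)
  have hK' : ∀ i w, |fderiv ℝ φ w (spaceDir i)| ≤ K := fun i w => by
    refine ((fderiv ℝ φ w).le_opNorm (spaceDir i)).trans ?_
    have : ‖(spaceDir i : SpaceTime d)‖ = 1 := by simp [spaceDir, Prod.norm_def]
    rw [this, mul_one]
    exact (hK₂ w).trans (le_max_right _ _)
  have hK0 : 0 ≤ K := (abs_nonneg _).trans (hK 0)
  refine ⟨d * (2 * K.toNNReal * (unitVol d).toNNReal), fun R hR u hu z hz => ?_⟩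
  refine (enorm_toLp_le_sum _).trans ?_
  refine (Finset.sum_le_card_nsmul _ _ _ fun i _ =>
    enorm_spaceDeriv_le hφ hφc hφs hφ1 hu hR i hK (hK' i) hz).trans ?_
  simp only [Finset.card_univ, Fintype.card_fin, nsmul_eq_mul]
  have e1 : ENNReal.ofReal (K / R) ≤ 2 * ENNReal.ofReal K * (ENNReal.ofReal R)⁻¹ := by
    rw [div_eq_mul_inv, ENNReal.ofReal_mul hK0, ENNReal.ofReal_inv_of_pos hR, mul_assoc]
    exact le_mul_of_one_le_left' one_le_two
  have e2 : ENNReal.ofReal (2 * K * R) = 2 * ENNReal.ofReal K * ENNReal.ofReal R := by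
    rw [ENNReal.ofReal_mul (by positivity), ENNReal.ofReal_mul zero_le_two, ENNReal.ofReal_ofNat]
  have e3 : ((d * (2 * K.toNNReal * (unitVol d).toNNReal) : ℝ≥0) : ℝ≥0∞) =
      d * (2 * ENNReal.ofReal K * unitVol d) := by
    push_cast
    rw [ENNReal.coe_toNNReal unitVol_ne_top]
    rfl
  rw [e3, e2]
  calc _ ≤ (d : ℝ≥0∞) * (2 * ENNReal.ofReal K * (ENNReal.ofReal R)⁻¹ *
        (unitVol d * ⨍⁻ w in cylinder (ENNReal.ofReal R) 0, ‖u w‖ₑ ∂volume) +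
      2 * ENNReal.ofReal K * ENNReal.ofReal R * (unitVol d * ∫⁻ l in Ioc (0 : ℝ) 1,
        ⨍⁻ w in cylinder (ENNReal.ofReal (l * R)) (shrink z l),
          ENNReal.ofReal (|timeDeriv u w| + ‖spaceHess u w‖) ∂volume)) := by gcongr
    _ = _ := by ring

/-! ### Hedberg's splitting -/

/-- Splitting the integral over the radii at the optimal radius. -/
theorem ofReal_mul_lintegral_le {β : ℝ} (hβ : 1 < β) {R : ℝ} (hR : 0 < R) {m e : ℝ}
    (hm : 0 ≤ m) (he : 0 ≤ e) {A : ℝ → ℝ≥0∞}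
    (hA : ∀ l ∈ Ioc (0 : ℝ) 1, A l ≤ ENNReal.ofReal m)
    (hA' : ∀ l ∈ Ioc (0 : ℝ) 1, A l ≤ ENNReal.ofReal ((l * R) ^ (-β) * e)) :
    ENNReal.ofReal R * ∫⁻ l in Ioc (0 : ℝ) 1, A l ≤
      ENNReal.ofReal ((1 + (β - 1)⁻¹) * (m ^ (1 - 1 / β) * e ^ (1 / β))) := by
  have hβ0 : 0 < β := by linarith
  rcases hm.eq_or_lt with rfl | hm
  · have : ∫⁻ l in Ioc (0 : ℝ) 1, A l = 0 := by
      rw [setLIntegral_congr_fun (g := fun _ => 0) measurableSet_Ioc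
        fun l hl => le_antisymm ((hA l hl).trans (by simp)) zero_le]
      simp
    simp [this]
  rcases he.eq_or_lt with rfl | he
  · have : ∫⁻ l in Ioc (0 : ℝ) 1, A l = 0 := by
      rw [setLIntegral_congr_fun (g := fun _ => 0) measurableSet_Ioc
        fun l hl => le_antisymm ((hA' l hl).trans (by simp)) zero_le]
      simp
    simp [this]
  -- The radius at which the two bounds agree, `δ ^ (-β) * e = m`; in the variable `l` it becomes
  -- `ε`. If `ε ≥ 1`, the second piece is simply empty.
  set δ := (e / m) ^ (1 / β) with hδdef
  have hδ : 0 < δ := by positivity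
  set ε := δ / R with hεdef
  have hε : 0 < ε := by positivity
  have h1 : ∫⁻ l in Ioc (0 : ℝ) 1 ∩ Iic ε, A l ≤ ENNReal.ofReal (m * ε) := by
    calc _ ≤ ∫⁻ l in Ioc (0 : ℝ) 1 ∩ Iic ε, ENNReal.ofReal m :=
          setLIntegral_mono' (measurableSet_Ioc.inter measurableSet_Iic) fun l hl => hA l hl.1
      _ ≤ ENNReal.ofReal m * volume (Ioc 0 ε) := by
          rw [setLIntegral_const]
          gcongr
          exact fun l hl => ⟨hl.1.1, hl.2⟩
      _ = _ := by rw [Real.volume_Ioc, sub_zero, ENNReal.ofReal_mul hm.le]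
  -- The tail is extended to infinity, where `β > 1` makes it converge.
  have hint : ∫⁻ l in Ioi ε, ENNReal.ofReal (l ^ (-β)) = ENNReal.ofReal (ε ^ (1 - β) / (β - 1)) := by
    rw [← ofReal_integral_eq_lintegral_ofReal (integrableOn_Ioi_rpow_of_lt (by linarith) hε),
      integral_Ioi_rpow_of_lt (by linarith) hε]
    · congr 1
      rw [show -β + 1 = -(β - 1) by ring, neg_div_neg_eq, show -(β - 1) = 1 - β by ring]
    · filter_upwards [ae_restrict_mem measurableSet_Ioi] with l hl
      have : 0 < l := hε.trans hl
      positivity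
  have h2 : ∫⁻ l in Ioc (0 : ℝ) 1 \ Iic ε, A l ≤
      ENNReal.ofReal (R ^ (-β) * e * (ε ^ (1 - β) / (β - 1))) := by
    have hc : 0 ≤ R ^ (-β) * e := by positivity
    calc _ ≤ ∫⁻ l in Ioc (0 : ℝ) 1 \ Iic ε,
            ENNReal.ofReal (R ^ (-β) * e) * ENNReal.ofReal (l ^ (-β)) := by
          refine setLIntegral_mono' (measurableSet_Ioc.diff measurableSet_Iic) fun l hl => ?_
          refine (hA' l hl.1).trans_eq ?_
          rw [Real.mul_rpow hl.1.1.le hR.le, ← ENNReal.ofReal_mul hc]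
          ring_nf
      _ ≤ ∫⁻ l in Ioi ε, ENNReal.ofReal (R ^ (-β) * e) * ENNReal.ofReal (l ^ (-β)) :=
          lintegral_mono_set fun l hl => by simpa using hl.2
      _ = _ := by
          rw [lintegral_const_mul' _ _ ENNReal.ofReal_ne_top, hint, ← ENNReal.ofReal_mul hc]
  have h3 : R * (m * ε) = m ^ (1 - 1 / β) * e ^ (1 / β) := by
    rw [hεdef, hδdef, Real.div_rpow he.le hm.le, Real.rpow_sub hm, Real.rpow_one]
    field_simp
  have h4 : R * (R ^ (-β) * e * (ε ^ (1 - β) / (β - 1))) =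
      (β - 1)⁻¹ * (m ^ (1 - 1 / β) * e ^ (1 / β)) := by
    have h5 : ε ^ (1 - β) = (e / m) ^ (1 / β - 1) * R ^ (β - 1) := by
      rw [hεdef, hδdef, Real.div_rpow (by positivity) hR.le, ← Real.rpow_mul (by positivity),
        show 1 - β = -(β - 1) by ring, Real.rpow_neg hR.le, div_inv_eq_mul]
      congr 2
      field_simp
      ring
    rw [h5, Real.div_rpow he.le hm.le, Real.rpow_sub he, Real.rpow_sub hm, Real.rpow_sub hm,
      Real.rpow_sub hR, Real.rpow_neg hR.le, Real.rpow_one, Real.rpow_one, Real.rpow_one]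
    field_simp
  calc _ = ENNReal.ofReal R * (∫⁻ l in Ioc (0 : ℝ) 1 ∩ Iic ε, A l) +
        ENNReal.ofReal R * ∫⁻ l in Ioc (0 : ℝ) 1 \ Iic ε, A l := by
        rw [← lintegral_inter_add_sdiff A (Ioc 0 1) measurableSet_Iic, mul_add]
    _ ≤ ENNReal.ofReal R * ENNReal.ofReal (m * ε) +
        ENNReal.ofReal R * ENNReal.ofReal (R ^ (-β) * e * (ε ^ (1 - β) / (β - 1))) := by gcongr
    _ = _ := by
        rw [← ENNReal.ofReal_mul hR.le, ← ENNReal.ofReal_mul hR.le, h3, h4, add_mul, one_mul,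
          ENNReal.ofReal_add (by positivity)
            (mul_nonneg (inv_nonneg.2 (by linarith)) (by positivity))]

/-! ### Geometry of the contracted cylinders -/

theorem self_mem_cylinder {ρ : ℝ} (hρ : 0 < ρ) (z : SpaceTime d) :
    z ∈ cylinder (ENNReal.ofReal ρ) z := by
  rw [mem_cylinder_ofReal hρ]
  have : 0 < ρ ^ 2 := by positivity
  exact ⟨by simpa using hρ, le_rfl, by linarith⟩

section Geometry

variable {R l : ℝ} {z : SpaceTime d}

theorem shrink_mem_cylinder (hR : 0 < R) (hz : z ∈ cylinder (ENNReal.ofReal R) 0)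
    (hl : l ∈ Ioc (0 : ℝ) 1) : shrink z l ∈ cylinder (ENNReal.ofReal R) 0 := by
  rw [mem_cylinder_ofReal hR] at hz ⊢
  simp only [Prod.snd_zero, zero_sub, norm_neg, Prod.fst_zero, zero_add] at hz ⊢
  obtain ⟨h1, h2, h3⟩ := hz
  have h4 : 0 < l ^ 2 := pow_pos hl.1 2
  have h5 : l ^ 2 ≤ 1 := pow_le_one₀ hl.1.le hl.2
  refine ⟨?_, ?_, ?_⟩
  · rw [shrink, norm_smul, Real.norm_eq_abs, abs_of_nonneg (by linarith [hl.2])]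
    nlinarith [hl.1, norm_nonneg z.2]
  · exact mul_nonneg (by linarith) h2
  · simp only [shrink]; nlinarith

/-- The bounds add up convexly: `(1 - l) R + l R = R` in space and `(1 - l²) R² + l² R² = R²` in
time. -/
theorem cylinder_shrink_subset (hR : 0 < R) (hz : z ∈ cylinder (ENNReal.ofReal R) 0)
    (hl : l ∈ Ioc (0 : ℝ) 1) :
    cylinder (ENNReal.ofReal (l * R)) (shrink z l) ⊆ cylinder (ENNReal.ofReal R) 0 := by
  intro w hw
  rw [mem_cylinder_ofReal hR] at hz ⊢
  rw [mem_cylinder_ofReal (mul_pos hl.1 hR)] at hw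
  simp only [Prod.snd_zero, zero_sub, norm_neg, Prod.fst_zero, zero_add, shrink] at hz hw ⊢
  obtain ⟨h1, h2, h3⟩ := hz
  obtain ⟨h6, h7, h8⟩ := hw
  have h4 : 0 < l ^ 2 := pow_pos hl.1 2
  have h5 : l ^ 2 ≤ 1 := pow_le_one₀ hl.1.le hl.2
  refine ⟨?_, ?_, ?_⟩
  · have h9 : ‖(1 - l) • z.2‖ ≤ (1 - l) * R := by
      rw [norm_smul, Real.norm_eq_abs, abs_of_nonneg (by linarith [hl.2])]
      exact mul_le_mul_of_nonneg_left h1.le (by linarith [hl.2])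
    have h10 : ‖w.2‖ ≤ ‖(1 - l) • z.2‖ + ‖(1 - l) • z.2 - w.2‖ := by
      simpa using norm_sub_le ((1 - l) • z.2) ((1 - l) • z.2 - w.2)
    nlinarith
  · exact (mul_nonneg (by linarith) h2).trans h7
  · nlinarith

/-- The smaller cylinder is the image of `C_R` under the contraction, and `z` is the fixed point of
that contraction. -/
theorem mem_cylinder_shrink (hR : 0 < R) (hz : z ∈ cylinder (ENNReal.ofReal R) 0)
    (hl : l ∈ Ioc (0 : ℝ) 1) : z ∈ cylinder (ENNReal.ofReal (l * R)) (shrink z l) := by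
  rw [mem_cylinder_ofReal hR] at hz
  rw [mem_cylinder_ofReal (mul_pos hl.1 hR)]
  simp only [Prod.snd_zero, zero_sub, norm_neg, Prod.fst_zero, zero_add, shrink] at hz ⊢
  obtain ⟨h1, h2, h3⟩ := hz
  have h4 : 0 < l ^ 2 := pow_pos hl.1 2
  refine ⟨?_, by nlinarith, by nlinarith⟩
  rw [sub_smul, one_smul, sub_sub_cancel_left, norm_neg, norm_smul, Real.norm_eq_abs,
    abs_of_pos hl.1]
  exact mul_lt_mul_of_pos_left h1 hl.1

/-- The base point of a cylinder of radius `3ρ` absorbing the part in `t ≥ 0` of all cylinders of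
radius at most `ρ` that meet the cylinder of radius `ρ` based at `z`. -/
noncomputable def absorbBase (ρ : ℝ) (z : SpaceTime d) : SpaceTime d := (max (z.1 - ρ ^ 2) 0, z.2)

/-- The supremum in the Morrey norm runs only over base points in `Q`; truncating the time at `0`
keeps the enlarged cylinder admissible. -/
theorem absorbBase_mem (hR : 0 < R) (hz : z ∈ cylinder (ENNReal.ofReal R) 0) (ρ : ℝ) :
    absorbBase ρ z ∈ cylinder (ENNReal.ofReal R) 0 := by
  rw [mem_cylinder_ofReal hR] at hz ⊢
  refine ⟨hz.1, le_max_right _ _, max_lt ?_ (lt_of_le_of_lt hz.2.1 hz.2.2)⟩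
  nlinarith [hz.2.2]

/-- A cylinder through `p` may start up to `σ²` earlier than `p`, hence the base time is lowered by
`ρ²`. The spatial distance is below `ρ + 2σ ≤ 3ρ`, and the elapsed time is below `3ρ² ≤ (3ρ)²`. -/
theorem mem_cylinder_absorbBase {ρ σ : ℝ} (hσ : 0 < σ) (h : σ ≤ ρ) {y p w : SpaceTime d}
    (hpy : p ∈ cylinder (ENNReal.ofReal σ) y) (hpz : p ∈ cylinder (ENNReal.ofReal ρ) z)
    (hwy : w ∈ cylinder (ENNReal.ofReal σ) y) (hw : 0 ≤ w.1) :
    w ∈ cylinder (ENNReal.ofReal (3 * ρ)) (absorbBase ρ z) := by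
  have hρ : 0 < ρ := hσ.trans_le h
  rw [mem_cylinder_ofReal hσ] at hpy hwy
  rw [mem_cylinder_ofReal hρ] at hpz
  rw [mem_cylinder_ofReal (by positivity)]
  have h1 : σ ^ 2 ≤ ρ ^ 2 := by gcongr
  have h2 := le_max_left (z.1 - ρ ^ 2) 0
  refine ⟨?_, max_le (by linarith) hw, ?_⟩
  · have h3 := norm_sub_le_norm_sub_add_norm_sub z.2 p.2 y.2
    have h4 := norm_sub_le_norm_sub_add_norm_sub z.2 y.2 w.2
    rw [norm_sub_rev p.2 y.2] at h3
    simp only [absorbBase]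
    linarith
  · simp only [absorbBase]
    nlinarith

end Geometry

/-! ### Averages and the Morrey norm -/

section Morrey

variable {F : Type*} [NormedAddCommGroup F] {p β : ℝ} {Q : Set (SpaceTime d)}
  {g : SpaceTime d → F}

theorem le_morreyNorm {ρ : ℝ} (hρ : 0 < ρ) {z : SpaceTime d} (hz : z ∈ Q) :
    ENNReal.ofReal ρ ^ β *
      (⨍⁻ w in cylinder (ENNReal.ofReal ρ) z, ‖Q.indicator g w‖ₑ ^ p ∂volume) ^ (1 / p) ≤
      morreyNorm p β Q g :=
  le_iSup_of_le ρ <| le_iSup_of_le hρ <| le_iSup_of_le z <| le_iSup_of_le hz le_rfl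

theorem ofReal_rpow_mul_rpow_neg {ρ : ℝ} (hρ : 0 < ρ) (a : ℝ) :
    ENNReal.ofReal ρ ^ a * ENNReal.ofReal ρ ^ (-a) = 1 := by
  rw [← ENNReal.rpow_add _ _ (by simpa using hρ) ENNReal.ofReal_ne_top, add_neg_cancel,
    ENNReal.rpow_zero]

theorem laverage_rpow_le_morreyNorm {ρ : ℝ} (hρ : 0 < ρ) {z : SpaceTime d} (hz : z ∈ Q) :
    (⨍⁻ w in cylinder (ENNReal.ofReal ρ) z, ‖Q.indicator g w‖ₑ ^ p ∂volume) ^ (1 / p) ≤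
      ENNReal.ofReal ρ ^ (-β) * morreyNorm p β Q g := by
  calc _ = ENNReal.ofReal ρ ^ (-β) * (ENNReal.ofReal ρ ^ β * (⨍⁻ w in cylinder (ENNReal.ofReal ρ) z,
        ‖Q.indicator g w‖ₑ ^ p ∂volume) ^ (1 / p)) := by
        rw [← mul_assoc, mul_comm (_ ^ (-β)), ofReal_rpow_mul_rpow_neg hρ, one_mul]
    _ ≤ _ := by gcongr; exact le_morreyNorm hρ hz

theorem lintegral_rpow_le_morreyNorm (hp : 0 < p) {ρ : ℝ} (hρ : 0 < ρ) {z : SpaceTime d}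
    (hz : z ∈ Q) :
    ∫⁻ w in cylinder (ENNReal.ofReal ρ) z, ‖Q.indicator g w‖ₑ ^ p ≤
      (ENNReal.ofReal ρ ^ (-β) * morreyNorm p β Q g) ^ p *
        volume (cylinder (ENNReal.ofReal ρ) z) := by
  have h := ENNReal.rpow_le_rpow (laverage_rpow_le_morreyNorm (g := g) (β := β) (p := p) hρ hz) hp.le
  rw [← ENNReal.rpow_mul, one_div_mul_cancel hp.ne', ENNReal.rpow_one, setLAverage_eq] at h
  exact (ENNReal.div_le_iff (volume_cylinder_ne_zero hρ z) (volume_cylinder_ne_top hρ z)).1 h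

theorem isProbabilityMeasure_cylinder {ρ : ℝ} (hρ : 0 < ρ) (z : SpaceTime d) :
    IsProbabilityMeasure ((volume (cylinder (ENNReal.ofReal ρ) z))⁻¹ •
      volume.restrict (cylinder (ENNReal.ofReal ρ) z)) :=
  ⟨by simp [ENNReal.inv_mul_cancel (volume_cylinder_ne_zero hρ z) (volume_cylinder_ne_top hρ z)]⟩

/-- Hölder's inequality for the normalised measure on the cylinder; the inclusion in `Q` makes the
indicator harmless. -/
theorem laverage_le_morreyNorm (hp : 1 ≤ p) {ρ : ℝ} (hρ : 0 < ρ) {z : SpaceTime d} (hz : z ∈ Q)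
    (hsub : cylinder (ENNReal.ofReal ρ) z ⊆ Q) (hg : StronglyMeasurable g) :
    ⨍⁻ w in cylinder (ENNReal.ofReal ρ) z, ‖g w‖ₑ ∂volume ≤
      ENNReal.ofReal ρ ^ (-β) * morreyNorm p β Q g := by
  refine le_trans ?_ (laverage_rpow_le_morreyNorm (g := g) (β := β) (p := p) hρ hz)
  have := isProbabilityMeasure_cylinder hρ z
  have h1 := eLpNorm'_le_eLpNorm'_of_exponent_le one_pos hp
    ((volume (cylinder (ENNReal.ofReal ρ) z))⁻¹ • volume.restrict (cylinder (ENNReal.ofReal ρ) z))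
    hg.aestronglyMeasurable
  simp only [eLpNorm', ENNReal.rpow_one, div_one] at h1
  rw [setLAverage_eq', setLAverage_eq']
  refine h1.trans (ENNReal.rpow_le_rpow (le_of_eq ?_) (by positivity))
  rw [lintegral_smul_measure, lintegral_smul_measure]
  congr 1
  refine setLIntegral_congr_fun (measurableSet_cylinder_ofReal hρ z) fun w hw => ?_
  simp only [indicator_of_mem (hsub hw)]

end Morrey

/-! ### The majorant and its `L^q` mean -/

section Majorant

variable {q β R ρ : ℝ} {f : SpaceTime d → ℝ} {z₀ : SpaceTime d}

/-- The part of `f` near the cylinder `C_ρ(z₀)`, inside `C_R`. -/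
noncomputable def localPart (R ρ : ℝ) (z₀ : SpaceTime d) (f : SpaceTime d → ℝ) :
    SpaceTime d → ℝ :=
  (cylinder (ENNReal.ofReal (3 * ρ)) (absorbBase ρ z₀)).indicator
    ((cylinder (ENNReal.ofReal R) 0).indicator f)

/-- A majorant on `C_ρ(z₀)` of the averages of `f` over the contracted cylinders: a local maximal
function plus a constant. -/
noncomputable def majorant (q β R ρ : ℝ) (z₀ : SpaceTime d) (f : SpaceTime d → ℝ)
    (z : SpaceTime d) : ℝ≥0∞ :=
  2 * maxFn ρ (fun w => ENNReal.ofReal (localPart R ρ z₀ f w)) z +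
    ENNReal.ofReal ρ ^ (-β) * morreyNorm q β (cylinder (ENNReal.ofReal R) 0) f

theorem measurable_majorant : Measurable (majorant q β R ρ z₀ f) :=
  ((measurable_maxFn _ _).const_mul 2).add_const _

theorem measurable_localPart (hR : 0 < R) (hρ : 0 < ρ) (hf : Continuous f) :
    Measurable (localPart R ρ z₀ f) :=
  (hf.measurable.indicator (measurableSet_cylinder_ofReal hR _)).indicator
    (measurableSet_cylinder_ofReal (by positivity) _)

theorem localPart_nonneg (hf0 : ∀ w, 0 ≤ f w) (w : SpaceTime d) : 0 ≤ localPart R ρ z₀ f w :=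
  indicator_nonneg (fun w _ => indicator_nonneg (fun w _ => hf0 w) w) w

theorem exists_localPart_le (hρ : 0 < ρ) (hf : Continuous f) :
    ∃ B, ∀ w, localPart R ρ z₀ f w ≤ B := by
  set y := absorbBase ρ z₀
  obtain ⟨B, hB⟩ := (isCompact_Icc.prod (isCompact_closedBall y.2 (3 * ρ))).exists_bound_of_continuousOn
    (s := Icc y.1 (y.1 + (3 * ρ) ^ 2) ×ˢ Metric.closedBall y.2 (3 * ρ)) hf.continuousOn
  have hy : y ∈ Icc y.1 (y.1 + (3 * ρ) ^ 2) ×ˢ Metric.closedBall y.2 (3 * ρ) :=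
    ⟨⟨le_rfl, by nlinarith⟩, Metric.mem_closedBall_self (by positivity)⟩
  refine ⟨B, fun w => ?_⟩
  have hB0 : 0 ≤ B := (norm_nonneg _).trans (hB y hy)
  refine indicator_apply_le' (fun hw => ?_) fun _ => hB0
  refine indicator_apply_le' (fun _ => ?_) fun _ => hB0
  rw [cylinder_ofReal_eq (by positivity)] at hw
  exact (le_abs_self _).trans
    (hB w ⟨Ico_subset_Icc_self hw.1, Metric.ball_subset_closedBall hw.2⟩)

/-- When `lR ≥ ρ`, Morrey decay gives `(lR)^(-β) E ≤ ρ^(-β) E`. When `lR ≤ ρ`, the cylinder lies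
where `localPart` agrees with `f`, and it fills half of a box containing `z`; hence the factor `2`
in `majorant`. -/
theorem laverage_le_majorant (hq : 1 ≤ q) (hβ : 0 < β) (hR : 0 < R)
    (hf : Continuous f) (hf0 : ∀ w, 0 ≤ f w) {z : SpaceTime d}
    (hz : z ∈ cylinder (ENNReal.ofReal R) 0) (hzρ : z ∈ cylinder (ENNReal.ofReal ρ) z₀) {l : ℝ}
    (hl : l ∈ Ioc (0 : ℝ) 1) :
    ⨍⁻ w in cylinder (ENNReal.ofReal (l * R)) (shrink z l), ENNReal.ofReal (f w) ∂volume ≤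
      majorant q β R ρ z₀ f z := by
  have hlR : 0 < l * R := mul_pos hl.1 hR
  have hmem := shrink_mem_cylinder hR hz hl
  have hsub := cylinder_shrink_subset hR hz hl
  have hfe : ∀ w, ENNReal.ofReal (f w) = ‖f w‖ₑ := fun w => (Real.enorm_of_nonneg (hf0 w)).symm
  rcases le_total ρ (l * R) with h | h
  · simp_rw [hfe]
    refine (laverage_le_morreyNorm (β := β) hq hlR hmem hsub hf.stronglyMeasurable).trans ?_
    refine le_trans ?_ le_add_self
    gcongr ?_ * _
    rw [ENNReal.rpow_neg, ENNReal.rpow_neg]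
    gcongr
  · refine le_trans ?_ le_self_add
    have hzl := mem_cylinder_shrink hR hz hl
    have h1 : ∀ w ∈ cylinder (ENNReal.ofReal (l * R)) (shrink z l),
        localPart R ρ z₀ f w = f w := fun w hw => by
      have hwQ := hsub hw
      have hw0 : 0 ≤ w.1 := ((mem_cylinder_ofReal hR _ _).1 hwQ).2.1
      rw [localPart, indicator_of_mem (mem_cylinder_absorbBase hlR h hzl hzρ hw hw0),
        indicator_of_mem hwQ]
    set C := cylinder (ENNReal.ofReal (l * R)) (shrink z l)
    have h2 : volume (box (l * R) (shrink z l)) = 2 * volume C := by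
      rw [volume_box hlR, volume_cylinder hlR, mul_assoc]
    calc _ = 2 * ((volume (box (l * R) (shrink z l)))⁻¹ *
          ∫⁻ w in C, ENNReal.ofReal (localPart R ρ z₀ f w)) := by
          rw [setLAverage_eq, h2, ENNReal.mul_inv (by simp) (by simp), ← mul_assoc, ← mul_assoc,
            ENNReal.mul_inv_cancel two_ne_zero (by simp), one_mul, div_eq_mul_inv, mul_comm]
          congr 1
          exact setLIntegral_congr_fun (measurableSet_cylinder_ofReal hlR _)
            fun w hw => by simp only [h1 w hw]
      _ ≤ 2 * ((volume (box (l * R) (shrink z l)))⁻¹ *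
          ∫⁻ w in box (l * R) (shrink z l), ENNReal.ofReal (localPart R ρ z₀ f w)) := by
          gcongr
          exact cylinder_subset_box hlR _
      _ ≤ _ := by
          gcongr
          exact le_maxFn _ hlR h (cylinder_subset_box hlR _ hzl)

/-- The constant in the strong type inequality for `maxFn`. -/
noncomputable def maxConst (d : ℕ) (q : ℝ) : ℝ≥0∞ :=
  ENNReal.ofReal q * (2 * 5 ^ (d + 2)) * (ENNReal.ofReal (q - 1))⁻¹ * ENNReal.ofReal (2 ^ (q - 1))

theorem maxConst_ne_top (d : ℕ) (hq : 1 < q) : maxConst d q ≠ ⊤ := by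
  have h : (ENNReal.ofReal (q - 1))⁻¹ ≠ ⊤ := by simpa using hq
  exact ENNReal.mul_ne_top (ENNReal.mul_ne_top (ENNReal.mul_ne_top ENNReal.ofReal_ne_top
    (by finiteness)) h) ENNReal.ofReal_ne_top

theorem majorant_ne_top (hρ : 0 < ρ) (hf : Continuous f)
    (hE : morreyNorm q β (cylinder (ENNReal.ofReal R) 0) f ≠ ⊤) (z : SpaceTime d) :
    majorant q β R ρ z₀ f z ≠ ⊤ := by
  obtain ⟨B, hB⟩ := exists_localPart_le (R := R) (z₀ := z₀) hρ hf
  refine ENNReal.add_ne_top.2 ⟨ENNReal.mul_ne_top (by simp) ?_, ENNReal.mul_ne_top ?_ hE⟩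
  · exact ne_top_of_le_ne_top ENNReal.ofReal_ne_top
      (maxFn_le_of_le (fun w => ENNReal.ofReal_le_ofReal (hB w)) z)
  · exact ENNReal.rpow_ne_top_of_ne_zero (by simpa using hρ) ENNReal.ofReal_ne_top

/-- The constant in the Morrey bound for `majorant`. -/
noncomputable def majorantConst (d : ℕ) (q : ℝ) : ℝ≥0∞ :=
  2 ^ (q - 1) * (2 ^ q * (maxConst d q * 3 ^ (d + 2)) + 1)

theorem majorantConst_ne_top (d : ℕ) (hq : 1 < q) : majorantConst d q ≠ ⊤ := by
  refine ENNReal.mul_ne_top (by finiteness) (ENNReal.add_ne_top.2 ⟨ENNReal.mul_ne_top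
    (ENNReal.rpow_ne_top_of_nonneg (by linarith) (by simp))
    (ENNReal.mul_ne_top (maxConst_ne_top d hq) (by finiteness)), by simp⟩)

/-- The strong type inequality reduces the maximal function to `localPart`, which lives on one
admissible cylinder of radius `3ρ`. The Morrey norm controls it there, and the volume ratio gives `3
^ (d + 2)`. -/
theorem laverage_majorant_rpow_le (hq : 1 < q) (hβ : 0 < β) (hR : 0 < R) (hρ : 0 < ρ)
    (hf : Continuous f) (hf0 : ∀ w, 0 ≤ f w) (hz₀ : z₀ ∈ cylinder (ENNReal.ofReal R) 0) :
    ⨍⁻ z in cylinder (ENNReal.ofReal ρ) z₀, majorant q β R ρ z₀ f z ^ q ∂volume ≤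
      majorantConst d q *
        (ENNReal.ofReal ρ ^ (-β) * morreyNorm q β (cylinder (ENNReal.ofReal R) 0) f) ^ q := by
  set E := morreyNorm q β (cylinder (ENNReal.ofReal R) 0) f with hE
  set X := ENNReal.ofReal ρ ^ (-β) * E with hX
  set V := volume (cylinder (ENNReal.ofReal ρ) z₀) with hV
  have hV0 : V ≠ 0 := volume_cylinder_ne_zero hρ z₀
  have hVt : V ≠ ⊤ := volume_cylinder_ne_top hρ z₀
  have hq0 : 0 < q := by linarith
  obtain ⟨B, hB⟩ := exists_localPart_le (R := R) (z₀ := z₀) hρ hf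
  have h1 := lintegral_maxFn_rpow_le ρ hq (measurable_localPart hR hρ hf)
    (localPart_nonneg (R := R) (ρ := ρ) (z₀ := z₀) hf0) hB
  have h3ρ : 0 < 3 * ρ := by positivity
  have h2 : ∫⁻ w, ENNReal.ofReal (localPart R ρ z₀ f w) ^ q ≤ X ^ q * (3 ^ (d + 2) * V) := by
    calc _ = ∫⁻ w in cylinder (ENNReal.ofReal (3 * ρ)) (absorbBase ρ z₀),
          ‖(cylinder (ENNReal.ofReal R) 0).indicator f w‖ₑ ^ q := by
          rw [← lintegral_indicator (measurableSet_cylinder_ofReal h3ρ _)]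
          refine lintegral_congr fun w => ?_
          rw [← Real.enorm_of_nonneg (localPart_nonneg hf0 w), localPart]
          by_cases hw : w ∈ cylinder (ENNReal.ofReal (3 * ρ)) (absorbBase ρ z₀)
          · rw [indicator_of_mem hw, indicator_of_mem hw]
          · rw [indicator_of_notMem hw, indicator_of_notMem hw, enorm_zero,
              ENNReal.zero_rpow_of_pos hq0]
      _ ≤ _ := lintegral_rpow_le_morreyNorm (β := β) hq0 h3ρ (absorbBase_mem hR hz₀ ρ)
      _ ≤ _ := by
          refine mul_le_mul' (ENNReal.rpow_le_rpow (mul_le_mul_left ?_ _) hq0.le) (le_of_eq ?_)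
          · rw [ENNReal.rpow_neg, ENNReal.rpow_neg]
            gcongr
            linarith
          · rw [volume_cylinder h3ρ, hV, volume_cylinder hρ, mul_pow,
              ENNReal.ofReal_mul (by positivity), ENNReal.ofReal_pow (by positivity),
              ENNReal.ofReal_ofNat, mul_assoc]
  have h3 : ∫⁻ z in cylinder (ENNReal.ofReal ρ) z₀, majorant q β R ρ z₀ f z ^ q ≤
      2 ^ (q - 1) * (2 ^ q * (maxConst d q * (X ^ q * (3 ^ (d + 2) * V))) + X ^ q * V) := by
    calc _ ≤ ∫⁻ z in cylinder (ENNReal.ofReal ρ) z₀, 2 ^ (q - 1) * (2 ^ q *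
            maxFn ρ (fun w => ENNReal.ofReal (localPart R ρ z₀ f w)) z ^ q + X ^ q) := by
          refine lintegral_mono fun z => ?_
          refine (ENNReal.rpow_add_le_mul_rpow_add_rpow _ _ hq.le).trans_eq ?_
          rw [ENNReal.mul_rpow_of_nonneg _ _ hq0.le]
      _ = 2 ^ (q - 1) * (2 ^ q * (∫⁻ z in cylinder (ENNReal.ofReal ρ) z₀,
            maxFn ρ (fun w => ENNReal.ofReal (localPart R ρ z₀ f w)) z ^ q) + X ^ q * V) := by
          rw [lintegral_const_mul' _ _ (by finiteness), lintegral_add_right _ measurable_const,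
            lintegral_const_mul' _ _ (ENNReal.rpow_ne_top_of_nonneg hq0.le (by simp)),
            setLIntegral_const]
      _ ≤ _ := by
          gcongr
          refine (setLIntegral_le_lintegral _ _).trans (h1.trans ?_)
          rw [maxConst]
          gcongr
  rw [setLAverage_eq, ENNReal.div_le_iff hV0 hVt]
  refine h3.trans_eq ?_
  rw [majorantConst]
  ring

end Majorant

/-! ### The estimate for finite radius -/

/-- The Morrey norm of a constant on a cylinder. -/
theorem rpow_mul_laverage_indicator_le {γ r R ρ : ℝ} (hr : 0 < r) (hγ : 0 ≤ γ)
    (hγr : γ * r ≤ (d : ℝ) + 2) (hR : 0 < R) (hρ : 0 < ρ) (z : SpaceTime d) (a : ℝ≥0∞) :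
    ENNReal.ofReal ρ ^ γ * (⨍⁻ w in cylinder (ENNReal.ofReal ρ) z,
      (cylinder (ENNReal.ofReal R) (0 : SpaceTime d)).indicator (fun _ => a) w ^ r ∂volume) ^ (1 / r) ≤
      ENNReal.ofReal R ^ γ * a := by
  set Q := cylinder (ENNReal.ofReal R) (0 : SpaceTime d) with hQ
  set S := cylinder (ENNReal.ofReal ρ) z with hS
  have hQm : MeasurableSet Q := measurableSet_cylinder_ofReal hR _
  have hV0 : volume S ≠ 0 := volume_cylinder_ne_zero hρ z
  have hVt : volume S ≠ ⊤ := volume_cylinder_ne_top hρ z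
  have h1 : ⨍⁻ w in S, Q.indicator (fun _ => a) w ^ r ∂volume = a ^ r * (volume (Q ∩ S) / volume S) := by
    have : ∀ w, Q.indicator (fun _ => a) w ^ r = Q.indicator (fun _ => a ^ r) w := fun w => by
      by_cases hw : w ∈ Q
      · rw [indicator_of_mem hw, indicator_of_mem hw]
      · rw [indicator_of_notMem hw, indicator_of_notMem hw, ENNReal.zero_rpow_of_pos hr]
    simp_rw [this]
    rw [setLAverage_eq, lintegral_indicator_const hQm, Measure.restrict_apply hQm, mul_div_assoc]
  rw [h1, ENNReal.mul_rpow_of_nonneg _ _ (by positivity), ← ENNReal.rpow_mul,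
    mul_one_div_cancel hr.ne', ENNReal.rpow_one, mul_left_comm, mul_comm _ a]
  gcongr a * ?_
  -- For `ρ ≤ R` the mean of the indicator is at most `1`. For `ρ ≥ R` it is at most `(R / ρ) ^ (d +
  -- 2)`, which beats `ρ ^ γ` because `γ r ≤ d + 2`.
  rcases le_total ρ R with h | h
  · have h2 : volume (Q ∩ S) / volume S ≤ 1 :=
      ENNReal.div_le_of_le_mul (by rw [one_mul]; exact measure_mono inter_subset_right)
    calc _ ≤ ENNReal.ofReal R ^ γ * 1 ^ (1 / r) := by gcongr
      _ = _ := by rw [ENNReal.one_rpow, mul_one]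
  · have h2 : volume (Q ∩ S) / volume S ≤ ENNReal.ofReal (R / ρ) ^ (γ * r) := by
      calc _ ≤ volume Q / volume S := by gcongr; exact inter_subset_left
        _ = ENNReal.ofReal (R / ρ) ^ ((d : ℝ) + 2) := by
          rw [hQ, hS, volume_cylinder hR, volume_cylinder hρ,
            ENNReal.mul_div_mul_right _ _ unitVol_ne_zero unitVol_ne_top,
            ← ENNReal.ofReal_div_of_pos (by positivity), ← div_pow,
            ENNReal.ofReal_pow (by positivity), ← ENNReal.rpow_natCast]
          push_cast; rfl
        _ ≤ _ := ENNReal.rpow_le_rpow_of_exponent_ge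
          (by rw [ENNReal.ofReal_le_one]; exact (div_le_one hρ).2 h) hγr
    calc _ ≤ ENNReal.ofReal ρ ^ γ * (ENNReal.ofReal (R / ρ) ^ (γ * r)) ^ (1 / r) := by gcongr
      _ = (ENNReal.ofReal ρ * ENNReal.ofReal (R / ρ)) ^ γ := by
        rw [← ENNReal.rpow_mul, mul_assoc, mul_one_div_cancel hr.ne', mul_one,
          ENNReal.mul_rpow_of_nonneg _ _ hγ]
      _ = _ := by rw [← ENNReal.ofReal_mul hρ.le, mul_div_cancel₀ _ hρ.ne']

section Finite

variable {q β r R ρ : ℝ} {z₀ z : SpaceTime d}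

theorem ofReal_mul_lintegral_laverage_le {f : SpaceTime d → ℝ} (hq : 1 ≤ q) (hβ : 1 < β)
    (hR : 0 < R) (hρ : 0 < ρ) (hf : Continuous f) (hf0 : ∀ w, 0 ≤ f w)
    (hE : morreyNorm q β (cylinder (ENNReal.ofReal R) 0) f ≠ ⊤)
    (hz : z ∈ cylinder (ENNReal.ofReal R) 0) (hzρ : z ∈ cylinder (ENNReal.ofReal ρ) z₀) :
    ENNReal.ofReal R * ∫⁻ l in Ioc (0 : ℝ) 1,
        ⨍⁻ w in cylinder (ENNReal.ofReal (l * R)) (shrink z l), ENNReal.ofReal (f w) ∂volume ≤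
      ENNReal.ofReal (1 + (β - 1)⁻¹) * (majorant q β R ρ z₀ f z ^ (1 - 1 / β) *
        morreyNorm q β (cylinder (ENNReal.ofReal R) 0) f ^ (1 / β)) := by
  have hβ0 : 0 < β := by linarith
  have hM := majorant_ne_top (z₀ := z₀) hρ hf hE z
  have h1 : 0 ≤ 1 - 1 / β := by rw [sub_nonneg, div_le_one hβ0]; exact hβ.le
  have h2 : 0 ≤ 1 + (β - 1)⁻¹ := add_nonneg zero_le_one (inv_nonneg.2 (by linarith))
  refine (ofReal_mul_lintegral_le hβ hR (m := (majorant q β R ρ z₀ f z).toReal)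
    (e := (morreyNorm q β (cylinder (ENNReal.ofReal R) 0) f).toReal)
    ENNReal.toReal_nonneg ENNReal.toReal_nonneg (fun l hl => ?_) fun l hl => ?_).trans_eq ?_
  · rw [ENNReal.ofReal_toReal hM]
    exact laverage_le_majorant hq hβ0 hR hf hf0 hz hzρ hl
  · have hlR : 0 < l * R := mul_pos hl.1 hR
    rw [ENNReal.ofReal_mul (p := (l * R) ^ (-β)) (by positivity), ENNReal.ofReal_toReal hE,
      ← ENNReal.ofReal_rpow_of_pos hlR]
    simp_rw [show ∀ w, ENNReal.ofReal (f w) = ‖f w‖ₑ from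
      fun w => (Real.enorm_of_nonneg (hf0 w)).symm]
    exact laverage_le_morreyNorm hq hlR (shrink_mem_cylinder hR hz hl)
      (cylinder_shrink_subset hR hz hl) hf.stronglyMeasurable
  · rw [ENNReal.ofReal_mul h2, ENNReal.ofReal_mul (by positivity),
      ← ENNReal.ofReal_rpow_of_nonneg ENNReal.toReal_nonneg h1,
      ← ENNReal.ofReal_rpow_of_nonneg ENNReal.toReal_nonneg (by positivity),
      ENNReal.ofReal_toReal hM, ENNReal.ofReal_toReal hE]

/-- The Morrey bound for the main term. -/
theorem rpow_mul_laverage_majorant_le {f : SpaceTime d → ℝ} (hq : 1 < q) (hβ : 1 < β)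
    (hr : r * (β - 1) = q * β) (hR : 0 < R) (hρ : 0 < ρ) (hf : Continuous f)
    (hf0 : ∀ w, 0 ≤ f w) (hz₀ : z₀ ∈ cylinder (ENNReal.ofReal R) 0) (a : ℝ≥0∞) :
    ENNReal.ofReal ρ ^ (β - 1) * (⨍⁻ z in cylinder (ENNReal.ofReal ρ) z₀,
      (a * (majorant q β R ρ z₀ f z ^ (1 - 1 / β) *
        morreyNorm q β (cylinder (ENNReal.ofReal R) 0) f ^ (1 / β))) ^ r ∂volume) ^ (1 / r) ≤
      a * majorantConst d q ^ (1 / r) * morreyNorm q β (cylinder (ENNReal.ofReal R) 0) f := by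
  set E := morreyNorm q β (cylinder (ENNReal.ofReal R) 0) f with hE
  have hβ0 : 0 < β := by linarith
  have hβ1 : 0 < β - 1 := by linarith
  have hr0 : 0 < r := by
    have : 0 < r * (β - 1) := by rw [hr]; positivity
    exact (pos_iff_pos_of_mul_pos this).2 hβ1
  -- This is where the relation between `r`, `q` and `β` enters: the `r`-th power of the
  -- interpolated bound is the `q`-th power of the majorant.
  have hexp : (1 - 1 / β) * r = q := by
    have : (1 - 1 / β) * r = r * (β - 1) / β := by field_simp
    rw [this, hr]; field_simp
  have hexp1 : q * (1 / r) = 1 - 1 / β := by rw [← hexp]; field_simp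
  have h1 : ⨍⁻ z in cylinder (ENNReal.ofReal ρ) z₀,
      (a * (majorant q β R ρ z₀ f z ^ (1 - 1 / β) * E ^ (1 / β))) ^ r ∂volume =
      (a * E ^ (1 / β)) ^ r * ⨍⁻ z in cylinder (ENNReal.ofReal ρ) z₀,
        majorant q β R ρ z₀ f z ^ q ∂volume := by
    rw [setLAverage_eq', setLAverage_eq',
      ← lintegral_const_mul _ (measurable_majorant.pow_const q)]
    refine lintegral_congr fun z => ?_
    rw [mul_comm (_ ^ (1 - 1 / β)), ← mul_assoc, ENNReal.mul_rpow_of_nonneg _ _ hr0.le,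
      ← ENNReal.rpow_mul, hexp]
  have h2 := laverage_majorant_rpow_le hq hβ0 hR hρ hf hf0 hz₀
  have h3 : 0 ≤ 1 / r := by positivity
  calc _ ≤ ENNReal.ofReal ρ ^ (β - 1) * ((a * E ^ (1 / β)) ^ r * (majorantConst d q *
        (ENNReal.ofReal ρ ^ (-β) * E) ^ q)) ^ (1 / r) := by rw [h1]; gcongr
    _ = ENNReal.ofReal ρ ^ (β - 1) * ENNReal.ofReal ρ ^ (-β * (1 - 1 / β)) *
        (a * majorantConst d q ^ (1 / r) * (E ^ (1 / β) * E ^ (1 - 1 / β))) := by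
        rw [ENNReal.mul_rpow_of_nonneg _ _ h3, ENNReal.mul_rpow_of_nonneg _ _ h3,
          ← ENNReal.rpow_mul, ← ENNReal.rpow_mul, mul_one_div_cancel hr0.ne', hexp1,
          ENNReal.rpow_one,
          ENNReal.mul_rpow_of_nonneg _ _ (by rw [← hexp1]; positivity), ← ENNReal.rpow_mul]
        ring
    -- The powers of `ρ` cancel, as `β - 1 = β (1 - 1/β)`, and the two powers of `E` have exponents
    -- summing to `1`.
    _ = _ := by
        rw [show -β * (1 - 1 / β) = -(β - 1) by field_simp, ofReal_rpow_mul_rpow_neg hρ, one_mul,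
          ← ENNReal.rpow_add_of_nonneg _ _ (by positivity) (by rw [← hexp1]; positivity),
          add_sub_cancel, ENNReal.rpow_one]

end Finite

/-- The estimate on cylinders of finite radius. -/
theorem exists_morreyNorm_spaceGrad_le (d : ℕ) {q β r : ℝ} (hq : 1 < q) (hβ : 1 < β)
    (hβq : β ≤ ((d : ℝ) + 2) / q) (hr : r * (β - 1) = q * β) :
    ∃ N : ℝ≥0, ∀ R : ℝ, 0 < R → ∀ u : SpaceTime d → ℝ, ContDiff ℝ ∞ u →
      morreyNorm r (β - 1) (cylinder (ENNReal.ofReal R) 0) (spaceGrad u) ≤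
        N * morreyNorm q β (cylinder (ENNReal.ofReal R) 0)
          (fun z => |timeDeriv u z| + ‖spaceHess u z‖) +
        N * (ENNReal.ofReal R ^ 2)⁻¹ * morreyNorm q β (cylinder (ENNReal.ofReal R) 0) u := by
  have hq0 : 0 < q := by linarith
  have hβ0 : 0 < β := by linarith
  have hβ1 : 0 < β - 1 := by linarith
  have hr0 : 0 < r := by
    have : 0 < r * (β - 1) := by rw [hr]; positivity
    exact (pos_iff_pos_of_mul_pos this).2 hβ1
  have hr1 : 1 ≤ r := by
    have : q * (β - 1) ≤ r * (β - 1) := by rw [hr]; nlinarith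
    exact hq.le.trans (le_of_mul_le_mul_right this hβ1)
  obtain ⟨K, hK⟩ := exists_enorm_spaceGrad_le d
  set c₁ : ℝ≥0∞ := K * ENNReal.ofReal (1 + (β - 1)⁻¹) with hc₁
  set c₂ : ℝ≥0∞ := c₁ * majorantConst d q ^ (1 / r) with hc₂
  have hc₂t : c₂ ≠ ⊤ := ENNReal.mul_ne_top (ENNReal.mul_ne_top (by simp) ENNReal.ofReal_ne_top)
    (ENNReal.rpow_ne_top_of_nonneg (by positivity) (majorantConst_ne_top d hq))
  -- The summand `1` keeps the constant nonzero, so that the right side is infinite when `E = ⊤`.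
  refine ⟨K + c₂.toNNReal + 1, fun R hR u hu => ?_⟩
  set Q := cylinder (ENNReal.ofReal R) (0 : SpaceTime d) with hQ
  set f : SpaceTime d → ℝ := fun z => |timeDeriv u z| + ‖spaceHess u z‖ with hf
  have hfc : Continuous f := continuous_timeDeriv_add_hess hu
  have hf0 : ∀ w, 0 ≤ f w := fun w => by positivity
  set E := morreyNorm q β Q f with hE
  set U := morreyNorm q β Q u with hU
  by_cases hEt : E = ⊤
  · rw [hEt, ENNReal.mul_top (by simp), top_add]
    exact le_top
  have hR' : ENNReal.ofReal R ≠ 0 := by simpa using hR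
  have hUle : (ENNReal.ofReal R)⁻¹ * (⨍⁻ w in Q, ‖u w‖ₑ ∂volume) ≤
      (ENNReal.ofReal R)⁻¹ * (ENNReal.ofReal R ^ (-β) * U) := by
    gcongr
    exact laverage_le_morreyNorm hq.le hR (self_mem_cylinder hR 0) subset_rfl
      hu.continuous.stronglyMeasurable
  set a : ℝ≥0∞ := K * ((ENNReal.ofReal R)⁻¹ * (ENNReal.ofReal R ^ (-β) * U)) with ha
  have hQm : MeasurableSet Q := measurableSet_cylinder_ofReal hR 0
  have key : ∀ ρ : ℝ, 0 < ρ → ∀ z₀ ∈ Q, ENNReal.ofReal ρ ^ (β - 1) *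
      (⨍⁻ w in cylinder (ENNReal.ofReal ρ) z₀, ‖Q.indicator (spaceGrad u) w‖ₑ ^ r ∂volume) ^ (1 / r) ≤
      ENNReal.ofReal R ^ (β - 1) * a + c₂ * E := by
    intro ρ hρ z₀ hz₀
    set A : SpaceTime d → ℝ≥0∞ := Q.indicator fun _ => a with hA
    set B : SpaceTime d → ℝ≥0∞ := fun z =>
      c₁ * (majorant q β R ρ z₀ f z ^ (1 - 1 / β) * E ^ (1 / β)) with hB
    have hpt : ∀ w ∈ cylinder (ENNReal.ofReal ρ) z₀,
        ‖Q.indicator (spaceGrad u) w‖ₑ ^ r ≤ (A + B) w ^ r := by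
      intro w hw
      refine ENNReal.rpow_le_rpow ?_ hr0.le
      by_cases hwQ : w ∈ Q
      · rw [indicator_of_mem hwQ, Pi.add_apply, hA, indicator_of_mem hwQ]
        refine (hK R hR u hu w hwQ).trans ?_
        rw [mul_add]
        refine add_le_add (mul_le_mul_right hUle _) ?_
        simp only [hB, hc₁]
        rw [mul_assoc]
        refine mul_le_mul_right ?_ _
        exact ofReal_mul_lintegral_laverage_le hq.le hβ hR hρ hfc hf0 hEt hwQ hw
      · rw [indicator_of_notMem hwQ, enorm_zero]
        exact zero_le
    have hAm : Measurable A := measurable_const.indicator hQm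
    have hBm : Measurable B := ((measurable_majorant.pow_const _).mul_const _).const_mul _
    calc _ ≤ ENNReal.ofReal ρ ^ (β - 1) *
          (⨍⁻ w in cylinder (ENNReal.ofReal ρ) z₀, (A + B) w ^ r ∂volume) ^ (1 / r) := by
          gcongr _ * ?_ ^ (1 / r)
          rw [setLAverage_eq, setLAverage_eq]
          gcongr ?_ / _
          exact setLIntegral_mono' (measurableSet_cylinder_ofReal hρ z₀) hpt
      _ ≤ ENNReal.ofReal ρ ^ (β - 1) *
          ((⨍⁻ w in cylinder (ENNReal.ofReal ρ) z₀, A w ^ r ∂volume) ^ (1 / r) +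
            (⨍⁻ w in cylinder (ENNReal.ofReal ρ) z₀, B w ^ r ∂volume) ^ (1 / r)) := by
          gcongr
          simp only [setLAverage_eq']
          exact ENNReal.lintegral_Lp_add_le hAm.aemeasurable hBm.aemeasurable hr1
      _ ≤ _ := by
          rw [mul_add]
          refine add_le_add (rpow_mul_laverage_indicator_le hr0 hβ1.le ?_ hR hρ z₀ a)
            (rpow_mul_laverage_majorant_le hq hβ hr hR hρ hfc hf0 hz₀ c₁)
          -- The growth condition for the constant term reads `(β - 1) r = q β ≤ d + 2`, which is
          -- the upper bound on `β`.
          rw [mul_comm, hr, mul_comm]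
          exact (le_div_iff₀ hq0).1 hβq
  have hpow : ENNReal.ofReal R ^ (β - 1) * a = K * (ENNReal.ofReal R ^ 2)⁻¹ * U := by
    have h1 : ENNReal.ofReal R ^ (β - 1) * ((ENNReal.ofReal R)⁻¹ * ENNReal.ofReal R ^ (-β)) =
        (ENNReal.ofReal R ^ 2)⁻¹ := by
      rw [← ENNReal.rpow_neg_one, ← ENNReal.rpow_add _ _ hR' ENNReal.ofReal_ne_top,
        ← ENNReal.rpow_add _ _ hR' ENNReal.ofReal_ne_top, ← ENNReal.rpow_ofNat,
        ← ENNReal.rpow_neg]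
      congr 1
      ring
    rw [ha, ← h1]
    ring
  refine iSup_le fun ρ => iSup_le fun hρ => iSup_le fun z₀ => iSup_le fun hz₀ =>
    (key ρ hρ z₀ hz₀).trans ?_
  rw [hpow, add_comm]
  have hN : ((K + c₂.toNNReal + 1 : ℝ≥0) : ℝ≥0∞) = K + c₂ + 1 := by
    push_cast
    rw [ENNReal.coe_toNNReal hc₂t]
  rw [hN]
  gcongr
  · exact le_add_self.trans le_self_add
  · exact le_self_add.trans le_self_add

/-! ### Passage to the half-space -/

theorem cylinder_zero_subset_top (R : ℝ≥0∞) :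
    cylinder R (0 : SpaceTime d) ⊆ cylinder ⊤ (0 : SpaceTime d) := fun w hw => by
  rw [mem_cylinder_top]
  exact hw.2.1

section

variable {F : Type*} [NormedAddCommGroup F]

theorem morreyNorm_mono_set {p β : ℝ} (hp : 0 < p) {Q Q' : Set (SpaceTime d)} (h : Q ⊆ Q')
    (g : SpaceTime d → F) : morreyNorm p β Q g ≤ morreyNorm p β Q' g := by
  refine iSup_le fun ρ => iSup_le fun hρ => iSup_le fun z => iSup_le fun hz =>
    le_trans ?_ (le_morreyNorm hρ (h hz))
  gcongr _ * ?_ ^ (1 / p)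
  rw [setLAverage_eq, setLAverage_eq]
  gcongr ?_ / _
  refine lintegral_mono fun w => ENNReal.rpow_le_rpow ?_ hp.le
  by_cases hw : w ∈ Q
  · rw [indicator_of_mem hw, indicator_of_mem (h hw)]
  · rw [indicator_of_notMem hw, enorm_zero]
    exact zero_le

/-- Every cylinder with base in the half-space `t ≥ 0` lies in all large cylinders based at `0`. -/
theorem exists_cylinder_subset {ρ : ℝ} (hρ : 0 < ρ) {z : SpaceTime d} (hz : 0 ≤ z.1) :
    ∃ R₀ : ℝ, 0 < R₀ ∧ ∀ R, R₀ ≤ R →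
      cylinder (ENNReal.ofReal ρ) z ⊆ cylinder (ENNReal.ofReal R) 0 := by
  -- The summand `1` forces `R ≥ 1`, so that `R ≤ R²` and the same `R` also dominates the time
  -- extent.
  refine ⟨1 + ‖z.2‖ + ρ + z.1 + ρ ^ 2, by positivity, fun R hR w hw => ?_⟩
  have hρ2 : 0 < ρ ^ 2 := by positivity
  have hR1 : 1 ≤ R := by linarith [norm_nonneg z.2]
  rw [mem_cylinder_ofReal hρ] at hw
  rw [mem_cylinder_ofReal (by linarith)]
  simp only [Prod.snd_zero, zero_sub, norm_neg, Prod.fst_zero, zero_add]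
  refine ⟨?_, hz.trans hw.2.1, ?_⟩
  · have h1 : ‖w.2‖ ≤ ‖z.2‖ + ‖z.2 - w.2‖ := by simpa using norm_sub_le z.2 (z.2 - w.2)
    linarith [hw.1]
  · nlinarith [hw.2.2, norm_nonneg z.2]

/-- The Morrey norm over the half-space is controlled by those over large cylinders. -/
theorem morreyNorm_top_le {p β : ℝ} {g : SpaceTime d → F} {f : ℝ → ℝ≥0∞} {c : ℝ≥0∞}
    (hf : Filter.Tendsto f Filter.atTop (nhds c))
    (h : ∀ R, 0 < R → morreyNorm p β (cylinder (ENNReal.ofReal R) 0) g ≤ f R) :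
    morreyNorm p β (cylinder ⊤ 0) g ≤ c := by
  refine iSup_le fun ρ => iSup_le fun hρ => iSup_le fun z => iSup_le fun hz => ?_
  obtain ⟨R₀, hR₀, hsub⟩ := exists_cylinder_subset hρ ((mem_cylinder_top _ _).1 hz)
  -- For fixed `ρ` and `z`, once `C_ρ(z)` lies in `C_R` the corresponding terms of the two suprema
  -- coincide. The threshold depends on `ρ` and `z`, but the limit `c` does not.
  refine ge_of_tendsto hf (Filter.eventually_atTop.2 ⟨R₀, fun R hR => ?_⟩)
  refine le_trans ?_ (h R (hR₀.trans_le hR))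
  refine le_trans (le_of_eq ?_) (le_morreyNorm hρ (hsub R hR (self_mem_cylinder hρ z)))
  rw [setLAverage_eq, setLAverage_eq]
  congr 3
  refine setLIntegral_congr_fun (measurableSet_cylinder_ofReal hρ z) fun w hw => ?_
  have hw' := hsub R hR hw
  simp only [indicator_of_mem hw', indicator_of_mem (cylinder_zero_subset_top _ hw')]

end

/-- Small radii are handled by the sup norm and `β ≥ 0`, large radii by the global `L^q` norm and `β
≤ (d + 2) / q`. -/
theorem morreyNorm_ne_top {q β : ℝ} (hq : 0 < q) (hβ : 0 ≤ β) (hβq : β ≤ ((d : ℝ) + 2) / q)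
    {u : SpaceTime d → ℝ} (hu : Continuous u) (huc : HasCompactSupport u)
    (Q : Set (SpaceTime d)) : morreyNorm q β Q u ≠ ⊤ := by
  obtain ⟨B, hB⟩ := hu.bounded_above_of_compact_support huc
  set I := ∫⁻ w, ‖u w‖ₑ ^ q with hI
  have hIt : I ≠ ⊤ := by
    have hs : ∀ w ∉ tsupport u, ‖u w‖ₑ ^ q = 0 := fun w hw => by
      rw [image_eq_zero_of_notMem_tsupport hw, enorm_zero, ENNReal.zero_rpow_of_pos hq]
    have h1 : I = ∫⁻ w in tsupport u, ‖u w‖ₑ ^ q := by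
      rw [hI, ← lintegral_indicator (isClosed_tsupport u).measurableSet]
      refine lintegral_congr fun w => ?_
      by_cases hw : w ∈ tsupport u
      · rw [indicator_of_mem hw]
      · rw [indicator_of_notMem hw, hs w hw]
    rw [h1]
    refine ne_top_of_le_ne_top (b := ENNReal.ofReal B ^ q * volume (tsupport u)) ?_ ?_
    · exact ENNReal.mul_ne_top (ENNReal.rpow_ne_top_of_nonneg hq.le ENNReal.ofReal_ne_top)
        huc.measure_lt_top.ne
    · rw [← setLIntegral_const]
      refine lintegral_mono fun w => ENNReal.rpow_le_rpow ?_ hq.le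
      rw [← ofReal_norm]
      exact ENNReal.ofReal_le_ofReal (hB w)
  have hle : ∀ w, ‖Q.indicator u w‖ₑ ≤ ‖u w‖ₑ := fun w => enorm_indicator_le_enorm_self _ _
  have hq' : 0 ≤ 1 / q := by positivity
  refine ne_top_of_le_ne_top (b := ENNReal.ofReal B + (I / unitVol d) ^ (1 / q)) ?_ ?_
  · exact ENNReal.add_ne_top.2 ⟨ENNReal.ofReal_ne_top, ENNReal.rpow_ne_top_of_nonneg hq'
      (ENNReal.div_ne_top hIt unitVol_ne_zero)⟩
  refine iSup_le fun ρ => iSup_le fun hρ => iSup_le fun z => iSup_le fun _ => ?_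
  rcases le_total ρ 1 with h | h
  · refine le_trans ?_ le_self_add
    have h1 : ⨍⁻ w in cylinder (ENNReal.ofReal ρ) z, ‖Q.indicator u w‖ₑ ^ q ∂volume ≤
        ENNReal.ofReal B ^ q := by
      rw [setLAverage_eq]
      refine ENNReal.div_le_of_le_mul ?_
      rw [← setLIntegral_const]
      refine lintegral_mono fun w => ENNReal.rpow_le_rpow ((hle w).trans ?_) hq.le
      rw [← ofReal_norm]
      exact ENNReal.ofReal_le_ofReal (hB w)
    calc _ ≤ 1 ^ β * (ENNReal.ofReal B ^ q) ^ (1 / q) := by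
          gcongr
          exact ENNReal.ofReal_le_one.2 h
      _ = _ := by
          rw [ENNReal.one_rpow, one_mul, ← ENNReal.rpow_mul, mul_one_div_cancel hq.ne',
            ENNReal.rpow_one]
  · refine le_trans ?_ le_add_self
    have hρ0 : ENNReal.ofReal ρ ≠ 0 := by simpa using hρ
    have h1 : ⨍⁻ w in cylinder (ENNReal.ofReal ρ) z, ‖Q.indicator u w‖ₑ ^ q ∂volume ≤
        ENNReal.ofReal ρ ^ (-((d : ℝ) + 2)) * (I / unitVol d) := by
      rw [setLAverage_eq, volume_cylinder hρ]
      have h2 : ∫⁻ w in cylinder (ENNReal.ofReal ρ) z, ‖Q.indicator u w‖ₑ ^ q ≤ I :=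
        (setLIntegral_le_lintegral _ _).trans
          (lintegral_mono fun w => ENNReal.rpow_le_rpow (hle w) hq.le)
      have h3 : ENNReal.ofReal ρ ^ (-((d : ℝ) + 2)) = (ENNReal.ofReal (ρ ^ (d + 2)))⁻¹ := by
        rw [ENNReal.rpow_neg, ENNReal.ofReal_pow hρ.le, ← ENNReal.rpow_natCast]
        push_cast; rfl
      rw [h3, div_eq_mul_inv, div_eq_mul_inv,
        ENNReal.mul_inv (Or.inr unitVol_ne_top) (Or.inl ENNReal.ofReal_ne_top), mul_left_comm]
      gcongr
    calc _ ≤ ENNReal.ofReal ρ ^ (((d : ℝ) + 2) / q) *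
          (ENNReal.ofReal ρ ^ (-((d : ℝ) + 2)) * (I / unitVol d)) ^ (1 / q) := by
          gcongr
          exact ENNReal.one_le_ofReal.2 h
      _ = _ := by
          rw [ENNReal.mul_rpow_of_nonneg _ _ hq', ← ENNReal.rpow_mul, ← mul_assoc,
            show -((d : ℝ) + 2) * (1 / q) = -(((d : ℝ) + 2) / q) by ring,
            ofReal_rpow_mul_rpow_neg hρ, one_mul]

end ParabolicMorrey

theorem theorem3p10 (d : ℕ) (hd : 1 ≤ d) (q β r : ℝ) (hq : 1 < q) (hqd : q < (d : ℝ) + 2)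
    (hβ : 1 < β) (hβq : β ≤ ((d : ℝ) + 2) / q) (hr : r * (β - 1) = q * β) :
    ∃ N : ℝ≥0, ∀ R : ℝ≥0∞, 0 < R → ∀ u : ParabolicMorrey.SpaceTime d → ℝ,
      ContDiff ℝ ∞ u → HasCompactSupport u →
        ParabolicMorrey.morreyNorm r (β - 1) (ParabolicMorrey.cylinder R 0)
            (ParabolicMorrey.spaceGrad u) ≤
          (N : ℝ≥0∞) * ParabolicMorrey.morreyNorm q β (ParabolicMorrey.cylinder R 0)
              (fun z => |ParabolicMorrey.timeDeriv u z| + ‖ParabolicMorrey.spaceHess u z‖) +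
            (N : ℝ≥0∞) * (R ^ 2)⁻¹ *
              ParabolicMorrey.morreyNorm q β (ParabolicMorrey.cylinder R 0) u := by
  obtain ⟨N, hN⟩ := ParabolicMorrey.exists_morreyNorm_spaceGrad_le d hq hβ hβq hr
  refine ⟨N, fun R hR u hu huc => ?_⟩
  have hq0 : 0 < q := by linarith
  by_cases hRt : R = ⊤
  · subst hRt
    rw [show ((⊤ : ℝ≥0∞) ^ 2)⁻¹ = 0 by simp, mul_zero, zero_mul, add_zero]
    set U := ParabolicMorrey.morreyNorm q β (ParabolicMorrey.cylinder ⊤ 0) u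
    -- Finiteness is what makes `R⁻² * U` tend to `0`, so the lower-order term disappears in the
    -- limit.
    have hU : U ≠ ⊤ := ParabolicMorrey.morreyNorm_ne_top hq0 (by linarith) hβq hu.continuous huc _
    set E := ParabolicMorrey.morreyNorm q β (ParabolicMorrey.cylinder ⊤ 0)
      (fun z => |ParabolicMorrey.timeDeriv u z| + ‖ParabolicMorrey.spaceHess u z‖)
    refine ParabolicMorrey.morreyNorm_top_le
      (f := fun R => N * E + N * (ENNReal.ofReal R ^ 2)⁻¹ * U) ?_ fun R hR => ?_
    · have h1 : Filter.Tendsto (fun R : ℝ => (ENNReal.ofReal R ^ 2)⁻¹) Filter.atTop (nhds 0) := by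
        rw [← ENNReal.inv_top, ← ENNReal.top_pow two_ne_zero]
        exact ((ENNReal.continuous_pow 2).tendsto ⊤ |>.comp ENNReal.tendsto_ofReal_atTop).inv
      have h2 := ENNReal.Tendsto.mul_const (ENNReal.Tendsto.const_mul h1
        (Or.inr (ENNReal.coe_ne_top (r := N)))) (Or.inr hU)
      simpa using h2.const_add (N * E)
    · refine (hN R hR u hu).trans ?_
      gcongr
      · exact ParabolicMorrey.morreyNorm_mono_set hq0
          (ParabolicMorrey.cylinder_zero_subset_top _) _
      · exact ParabolicMorrey.morreyNorm_mono_set hq0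
          (ParabolicMorrey.cylinder_zero_subset_top _) _
  · have h := hN R.toReal (ENNReal.toReal_pos hR.ne' hRt) u hu
    rwa [ENNReal.ofReal_toReal hRt] at h
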